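/- **Lemma 4.3 (A nonlocal Radial Lemma).** Let $N\ge 1$, $1<p<\infty$ and $s\in(0,1)$ with $sp<N$. For a measurable $u:\mathbb{R}^N\to\mathbb{R}$ and an open set $\Omega\subset\mathbb{R}^N$ put $$[u]_{D^{s,p}(\Omega)}=\Big(\int_{\Omega\times\Omega}\frac{|u(x)-u(y)|^p}{|x-y|^{N+sp}}\,dx\,dy\Big)^{1/p}.$$ For $R>0$ let $B_R\subset\mathbb{R}^N$ be the open ball of radius $R$ centered at the origin, and let $D^{s,p}_{0,\mathrm{rad}}(B_R)$ be the space of radially symmetric functions $u\in L^{p^*_s}(\mathbb{R}^N)$, $p^*_s=\frac{Np}{N-sp}$, such that $[u]_{D^{s,p}(\mathbb{R}^N)}<\infty$ and $u=0$ a.e. in $\mathbb{R}^N\setminus B_R$, normed by $[\,\cdot\,]_{D^{s,p}(\mathbb{R}^N)}$. We write $K\Subset\mathbb{R}^N\setminus\{0\}$ if $K$ is an open bounded set with compact closure contained in $\mathbb{R}^N\setminus\{0\}$. Then: * If $sp>1$, there is a constant $C=C(N,s,p)>0$ such that for every $R>0$ and every $u\in D^{s,p}_{0,\mathrm{rad}}(B_R)$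 $$|u(x)|\le C\,|x|^{-\frac{N-sp}{p}}\Big(\frac{R}{|x|}\Big)^{s}\,[u]_{D^{s,p}(B_R)}\qquad\text{for a.e. }x\in\mathbb{R}^N\setminus\{0\}.$$ Moreover $D^{s,p}_{0,\mathrm{rad}}(B_R)\hookrightarrow L^\infty_{\mathrm{loc}}(\mathbb{R}^N\setminus\{0\};|x|^{\frac{N-sp}{p}})$ continuously: for every $R>0$ and every $K\Subset\mathbb{R}^N\setminus\{0\}$ there is $C=C(N,s,p,R,K)>0$ such that for every $u\in D^{s,p}_{0,\mathrm{rad}}(B_R)$ one has $|x|^{\frac{N-sp}{p}}u\in L^\infty(K)$ and $$\big\||x|^{\frac{N-sp}{p}}u\big\|_{L^\infty(K)}\le C\,[u]_{D^{s,p}(\mathbb{R}^N)}.$$ * If $sp<1$, then $D^{s,p}_{0,\mathrm{rad}}(B_R)\hookrightarrow L^{\frac{p}{1-sp}}_{\mathrm{loc}}(\mathbb{R}^N\setminus\{0\})$ continuously: for every $K\Subset\mathbb{R}^N\setminus\{0\}$ there is $C=C(N,s,p,K)>0$ such that for every $R>0$ and every $u\in D^{s,p}_{0,\mathrm{rad}}(B_R)$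 one has $u\in L^{\frac{p}{1-sp}}(K)$ and $\|u\|_{L^{p/(1-sp)}(K)}\le C\,[u]_{D^{s,p}(\mathbb{R}^N)}$. * If $sp=1$, then $D^{s,p}_{0,\mathrm{rad}}(B_R)\hookrightarrow L^{t}_{\mathrm{loc}}(\mathbb{R}^N\setminus\{0\})$ continuously for every $1\le t<\infty$: for every such $t$ and every $K\Subset\mathbb{R}^N\setminus\{0\}$ there is $C=C(N,s,p,t,K)>0$ such that for every $R>0$ and every $u\in D^{s,p}_{0,\mathrm{rad}}(B_R)$ one has $u\in L^t(K)$ and $\|u\|_{L^t(K)}\le C\,[u]_{D^{s,p}(\mathbb{R}^N)}$. -/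

import Mathlib

open MeasureTheory
open scoped ENNReal

noncomputable section

/-- The Gagliardo seminorm
`[u]_{D^{s,p}(Ω)} = (∫_{Ω × Ω} |u(x) - u(y)|^p / |x - y|^{N + s p} dx dy)^{1/p}`,
with values in `[0, ∞]`. The choice `Ω = Set.univ` is the seminorm on the whole space.
(On the diagonal, which is a null set, the integrand reads `0 / 0 = 0`.) -/
def gagliardo {N : ℕ} (s p : ℝ) (Ω : Set (EuclideanSpace ℝ (Fin N)))
    (u : EuclideanSpace ℝ (Fin N) → ℝ) : ℝ≥0∞ :=
  (∫⁻ z in Ω ×ˢ Ω, ‖u z.1 - u z.2‖ₑ ^ p / ‖z.1 - z.2‖ₑ ^ ((N : ℝ) + s * p)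
    ∂((volume : Measure (EuclideanSpace ℝ (Fin N))).prod volume)) ^ (1 / p)

/-- Membership in `D^{s,p}_0(Ω)` (for `s p < N`): `u` is in `L^{p*}(ℝ^N)` with
`p* = N p / (N - s p)`, `[u]_{D^{s,p}(ℝ^N)} < ∞`, and `u = 0` a.e. outside `Ω`.
The norm of this space is `[u]_{D^{s,p}(ℝ^N)} = gagliardo s p Set.univ u`. -/
structure MemD0 {N : ℕ} (s p : ℝ) (Ω : Set (EuclideanSpace ℝ (Fin N)))
    (u : EuclideanSpace ℝ (Fin N) → ℝ) : Prop where
  memLp : MemLp u (ENNReal.ofReal ((N : ℝ) * p / ((N : ℝ) - s * p))) volume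
  seminorm_lt_top : gagliardo s p Set.univ u < ∞
  eq_zero : ∀ᵐ x ∂(volume : Measure (EuclideanSpace ℝ (Fin N))), x ∉ Ω → u x = 0

/-- `u` is radially symmetric: up to a null set it is a (Borel) function of `|x|`. -/
def IsRadial {N : ℕ} (u : EuclideanSpace ℝ (Fin N) → ℝ) : Prop :=
  ∃ f : ℝ → ℝ, Measurable f ∧
    ∀ᵐ x ∂(volume : Measure (EuclideanSpace ℝ (Fin N))), u x = f ‖x‖

/-- Membership in `D^{s,p}_{0,rad}(B_R)`, where `B_R` is the open ball of radius `R` centered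
at the origin. -/
def MemD0Rad {N : ℕ} (s p R : ℝ) (u : EuclideanSpace ℝ (Fin N) → ℝ) : Prop :=
  MemD0 s p (Metric.ball 0 R) u ∧ IsRadial u

/-- `K ⋐ E`: `K` is an open bounded set with compact closure contained in `E`
(a set with compact closure is bounded). -/
def CompactlyContained {N : ℕ} (K E : Set (EuclideanSpace ℝ (Fin N))) : Prop :=
  IsOpen K ∧ IsCompact (closure K) ∧ closure K ⊆ E

end

/-! A radial function is a function f of the single variable r = |x|, and away from the origin its
N-dimensional Gagliardo energy controls the one-dimensional energy of f with the same s and p. For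
|x| = ρ and a radius τ, the directions θ with |x - τθ| ≤ 2|ρ - τ| contain a spherical cap of measure
at least a multiple of (|ρ - τ| / max(ρ, τ))^(N-1). Averaging the kernel |x - y|^(-(N+sp)) over
spheres therefore leaves at least |ρ - τ|^(-(1+sp)), and the Jacobians divided by max(ρ, τ)^(N-1)
leave min(ρ, τ)^(N-1), which is at least a^(N-1) on radii ≥ a. This is `exists_radial_energy_le`;
the three cases are then the three regimes of one-dimensional fractional embedding.

For sp > 1 the tool is a Morrey inequality, `enorm_sub_le_gagliardo_Ioo`, proved by telescoping
averages over shrinking intervals. Joining ρ to radii near R, where f vanishes, gives ρ^((N-1)/p)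
|f(ρ)| ≤ C R^(s-1/p) [u] with the seminorm over B_R, and ρ < R turns this into the stated decay.

For sp ≤ 1 the tool is the Gagliardo–Nirenberg inequality `exists_sobolev_gagliardo`: |f(x)| is
compared with averages over balls around x and the radius is optimized at each x. On a half-line it
maps the exponent t to p(1 + st). If sp < 1 this map has the fixed point p/(1-sp), where the L^t
factor can be absorbed into the left side. If sp = 1 it adds p to the exponent, so iteration
starting from p* passes every finite t. The bound in L^(p*) is the N-dimensional Sobolev inequality,
obtained by the same absorption. -/

/-! ### Polar coordinates and the measure of spherical caps. -/

section Polar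

open Metric Set

variable {E : Type*} [NormedAddCommGroup E] [NormedSpace ℝ E] [MeasurableSpace E] [BorelSpace E]
  [FiniteDimensional ℝ E] [Nontrivial E] (μ : Measure E) [μ.IsAddHaarMeasure]

/-- Integration in polar coordinates. -/
theorem lintegral_eq_lintegral_toSphere_Ioi {g : E → ℝ≥0∞} (hg : Measurable g) :
    ∫⁻ x, g x ∂μ = ∫⁻ ω, (∫⁻ r in Ioi (0 : ℝ),
      ENNReal.ofReal (r ^ (Module.finrank ℝ E - 1)) * g (r • (ω : E))) ∂μ.toSphere := by
  have h1 : ∫⁻ x, g x ∂μ = ∫⁻ x : ({0}ᶜ : Set E), g x ∂(μ.comap (↑)) := by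
    rw [lintegral_subtype_comap (measurableSet_singleton _).compl g, restrict_compl_singleton]
  have h2 := μ.measurePreserving_homeomorphUnitSphereProd.lintegral_comp_emb
    (Homeomorph.measurableEmbedding _) (fun q => g (q.2.1 • (q.1 : E)))
  have h3 : ∀ x : ({0}ᶜ : Set E), ((homeomorphUnitSphereProd E x).2.1 •
      ((homeomorphUnitSphereProd E x).1 : E)) = x := by
    intro x
    have : (x : E) ≠ 0 := x.2
    simp [smul_smul, norm_ne_zero_iff.2 this]
  simp only [h3] at h2
  have hm : Measurable fun q : sphere (0 : E) 1 × Ioi (0 : ℝ) => g (q.2.1 • (q.1 : E)) := by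
    fun_prop
  rw [h1, h2, lintegral_prod _ hm.aemeasurable]
  refine lintegral_congr fun ω => ?_
  have hm2 : Measurable fun r : Ioi (0 : ℝ) => g (r.1 • (ω : E)) := by fun_prop
  rw [Measure.volumeIoiPow, lintegral_withDensity_eq_lintegral_mul _ (by fun_prop) hm2]
  exact lintegral_subtype_comap measurableSet_Ioi
    (fun r : ℝ => ENNReal.ofReal (r ^ (Module.finrank ℝ E - 1)) * g (r • (ω : E)))

theorem lintegral_fun_norm {F : ℝ → ℝ≥0∞} (hF : Measurable F) :
    ∫⁻ x, F ‖x‖ ∂μ = μ.toSphere univ * ∫⁻ r in Ioi (0 : ℝ),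
      ENNReal.ofReal (r ^ (Module.finrank ℝ E - 1)) * F r := by
  rw [lintegral_eq_lintegral_toSphere_Ioi μ (by fun_prop : Measurable fun x : E => F ‖x‖)]
  have : ∀ ω : sphere (0 : E) 1, ∫⁻ r in Ioi (0 : ℝ),
      ENNReal.ofReal (r ^ (Module.finrank ℝ E - 1)) * F ‖r • (ω : E)‖ =
      ∫⁻ r in Ioi (0 : ℝ), ENNReal.ofReal (r ^ (Module.finrank ℝ E - 1)) * F r := by
    intro ω
    refine setLIntegral_congr_fun measurableSet_Ioi fun r hr => ?_
    have : ‖r • (ω : E)‖ = r := by simp [norm_smul, abs_of_pos (mem_Ioi.1 hr)]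
    simp only [this]
  rw [lintegral_congr this, lintegral_const, mul_comm]

/-- Spherical caps of radius `δ` have measure at least a multiple of `δ ^ (n - 1)`. -/
theorem le_toSphere_ball {δ : ℝ} (hδ : 0 < δ) (hδ1 : δ ≤ 1) (ω : sphere (0 : E) 1) :
    μ (ball 0 1) / 8 ^ Module.finrank ℝ E * ENNReal.ofReal (δ ^ (Module.finrank ℝ E - 1)) ≤
      μ.toSphere (ball ω δ) := by
  set n := Module.finrank ℝ E with hn
  have hnpos : 0 < n := Module.finrank_pos
  -- The ball of radius δ/4 about ω lies in the cone over the cap, at radii within δ/4 of 1. Polar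
  -- coordinates bound its measure by cap × 2^(n-1) × δ/2, since these radii are at most 2.
  have key : μ (ball (ω : E) (δ / 4)) ≤
      μ.toSphere (ball ω δ) * (ENNReal.ofReal (2 ^ (n - 1)) * ENNReal.ofReal (δ / 2)) := by
    rw [← lintegral_indicator_one measurableSet_ball,
      lintegral_eq_lintegral_toSphere_Ioi μ (measurable_one.indicator measurableSet_ball),
      mul_comm, ← setLIntegral_const, ← lintegral_indicator measurableSet_ball]
    refine lintegral_mono fun θ => ?_
    by_cases hθ : θ ∈ ball ω δ
    · rw [indicator_of_mem hθ]
      calc _ ≤ ∫⁻ r in Ioi (0 : ℝ), (Ioo (1 - δ / 4) (1 + δ / 4)).indicator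
            (fun _ => ENNReal.ofReal (2 ^ (n - 1))) r := by
            refine setLIntegral_mono' measurableSet_Ioi fun r hr => ?_
            by_cases h : r • (θ : E) ∈ ball (ω : E) (δ / 4)
            · have hr' : r ∈ Ioo (1 - δ / 4) (1 + δ / 4) := by
                have h1 := abs_norm_sub_norm_le (r • (θ : E)) (ω : E)
                rw [mem_ball, dist_eq_norm] at h
                have : ‖r • (θ : E)‖ = r := by simp [norm_smul, abs_of_pos (mem_Ioi.1 hr)]
                rw [this, norm_eq_of_mem_sphere] at h1
                have := abs_lt.1 (h1.trans_lt h)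
                constructor <;> linarith [this.1, this.2]
              rw [indicator_of_mem h, indicator_of_mem hr', Pi.one_apply, mul_one]
              refine ENNReal.ofReal_le_ofReal (pow_le_pow_left₀ (le_of_lt hr) ?_ _)
              linarith [hr'.2]
            · simp [indicator_of_notMem h]
        _ ≤ ∫⁻ r, (Ioo (1 - δ / 4) (1 + δ / 4)).indicator
            (fun _ => ENNReal.ofReal (2 ^ (n - 1))) r := setLIntegral_le_lintegral _ _
        _ = _ := by
            rw [lintegral_indicator measurableSet_Ioo, setLIntegral_const, Real.volume_Ioo]
            congr 2
            ring
    · rw [indicator_of_notMem hθ, nonpos_iff_eq_zero]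
      rw [setLIntegral_congr_fun (g := fun _ => 0) measurableSet_Ioi, lintegral_zero]
      intro r hr
      have : r • (θ : E) ∉ ball (ω : E) (δ / 4) := by
        intro h
        apply hθ
        have h1 := abs_norm_sub_norm_le (r • (θ : E)) (ω : E)
        rw [mem_ball, dist_eq_norm] at h
        have h0 : ‖r • (θ : E)‖ = r := by simp [norm_smul, abs_of_pos (mem_Ioi.1 hr)]
        rw [h0, norm_eq_of_mem_sphere] at h1
        have h2 : ‖(θ : E) - r • (θ : E)‖ = |1 - r| := by
          rw [show (θ : E) - r • (θ : E) = (1 - r) • (θ : E) by simp [sub_smul], norm_smul,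
            norm_eq_of_mem_sphere, mul_one, Real.norm_eq_abs]
        have h3 := norm_add_le ((θ : E) - r • (θ : E)) (r • (θ : E) - (ω : E))
        rw [h2, sub_add_sub_cancel, abs_sub_comm] at h3
        rw [mem_ball, Subtype.dist_eq, dist_eq_norm]
        linarith
      simp [indicator_of_notMem this]
  rw [μ.addHaar_ball_of_pos _ (by positivity)] at key
  have h8 : ENNReal.ofReal (2 ^ (n - 1)) * ENNReal.ofReal (δ / 2) *
      ENNReal.ofReal (δ ^ (n - 1) / 8 ^ n) ≤ ENNReal.ofReal ((δ / 4) ^ n) := by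
    rw [← ENNReal.ofReal_mul (by positivity), ← ENNReal.ofReal_mul (by positivity)]
    refine ENNReal.ofReal_le_ofReal ?_
    obtain ⟨m, hm⟩ : ∃ m, n = m + 1 := ⟨n - 1, by omega⟩
    rw [hm, show m + 1 - 1 = m from rfl, show (8 : ℝ) = 2 * 4 by norm_num, mul_pow, div_pow,
      show (2 : ℝ) ^ m * (δ / 2) * (δ ^ m / (2 ^ (m + 1) * 4 ^ (m + 1))) =
        δ ^ (m + 1) / 4 ^ (m + 1) * (1 / 4) by field_simp; ring]
    exact mul_le_of_le_one_right (by positivity) (by norm_num)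
  have hA0 : ENNReal.ofReal (2 ^ (n - 1)) * ENNReal.ofReal (δ / 2) ≠ 0 := by
    simp [hδ]
  have hAt : ENNReal.ofReal (2 ^ (n - 1)) * ENNReal.ofReal (δ / 2) ≠ ∞ :=
    ENNReal.mul_ne_top ENNReal.ofReal_ne_top ENNReal.ofReal_ne_top
  have e1 : μ (ball 0 1) / 8 ^ n * ENNReal.ofReal (δ ^ (n - 1)) =
      ENNReal.ofReal (δ ^ (n - 1) / 8 ^ n) * μ (ball 0 1) := by
    rw [ENNReal.ofReal_div_of_pos (by positivity), ENNReal.ofReal_pow (p := 8) (by norm_num)]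
    simp only [div_eq_mul_inv, ENNReal.ofReal_ofNat]
    ring
  rw [e1, ← ENNReal.mul_le_mul_iff_right hA0 hAt, mul_comm _ (μ.toSphere _), ← mul_assoc]
  exact (mul_le_mul' h8 le_rfl).trans key

end Polar

/-! ### From the N-dimensional energy to the one-dimensional energy of the profile. -/

section RadialKernel

open Metric Set

variable {E : Type*} [NormedAddCommGroup E] [NormedSpace ℝ E] [MeasurableSpace E] [BorelSpace E]
  [FiniteDimensional ℝ E] [Nontrivial E] (μ : Measure E) [μ.IsAddHaarMeasure]

/-- Lower bound for the average over spheres of the kernel `‖x - y‖ ^ (-β)`. -/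
theorem lintegral_radial_kernel_le {H : ℝ → ℝ≥0∞} (hH : Measurable H) {β : ℝ} (hβ : 0 ≤ β)
    {x : E} (hx : x ≠ 0) :
    μ (ball 0 1) / 8 ^ Module.finrank ℝ E * ∫⁻ τ in Ioi (0 : ℝ),
      ENNReal.ofReal (τ ^ (Module.finrank ℝ E - 1)) *
        (ENNReal.ofReal ((|‖x‖ - τ| / max ‖x‖ τ) ^ (Module.finrank ℝ E - 1)) *
          (H τ / (2 * ‖‖x‖ - τ‖ₑ) ^ β)) ≤
      ∫⁻ y, H ‖y‖ / ‖x - y‖ₑ ^ β ∂μ := by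
  set n := Module.finrank ℝ E with hn
  set c := μ (ball 0 1) / 8 ^ n with hc
  have hcm : Measurable fun y : E => H ‖y‖ / ‖x - y‖ₑ ^ β := by fun_prop
  have hρ : 0 < ‖x‖ := norm_pos_iff.2 hx
  let ω : sphere (0 : E) 1 := ⟨‖x‖⁻¹ • x, by simp [norm_smul, hρ.ne']⟩
  have hω : x = ‖x‖ • (ω : E) := by simp [ω, smul_smul, hρ.ne']
  rw [lintegral_eq_lintegral_toSphere_Ioi μ hcm, lintegral_lintegral_swap (by fun_prop),
    ← lintegral_const_mul _ (by fun_prop)]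
  refine lintegral_mono_ae ?_
  have hne : ∀ᵐ τ ∂volume.restrict (Ioi (0 : ℝ)), τ ≠ ‖x‖ :=
    ae_restrict_of_ae (Measure.ae_ne volume ‖x‖)
  filter_upwards [hne, ae_restrict_mem measurableSet_Ioi] with τ hτ hτ0
  have hτ0 : 0 < τ := hτ0
  -- The maximum in the denominator ensures both δ ≤ 1 and ‖x‖ δ ≤ |‖x‖ - τ|. Hence a direction θ
  -- within δ of x/‖x‖ satisfies ‖x - τθ‖ ≤ ‖x‖ δ + |‖x‖ - τ| ≤ 2 |‖x‖ - τ|.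
  set δ := |‖x‖ - τ| / max ‖x‖ τ with hδdef
  have hmax : 0 < max ‖x‖ τ := lt_max_of_lt_left hρ
  have habs : 0 < |‖x‖ - τ| := abs_pos.2 (sub_ne_zero.2 hτ.symm)
  have hδ : 0 < δ := div_pos habs hmax
  have hδ1 : δ ≤ 1 := by
    rw [hδdef, div_le_one hmax, abs_le]
    constructor <;> linarith [le_max_left ‖x‖ τ, le_max_right ‖x‖ τ]
  have hρδ : ‖x‖ * δ ≤ |‖x‖ - τ| := by
    rw [hδdef, mul_div_assoc', div_le_iff₀ hmax, mul_comm]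
    exact mul_le_mul_of_nonneg_left (le_max_left _ _) habs.le
  calc c * (ENNReal.ofReal (τ ^ (n - 1)) * (ENNReal.ofReal (δ ^ (n - 1)) *
          (H τ / (2 * ‖‖x‖ - τ‖ₑ) ^ β)))
      = (ENNReal.ofReal (τ ^ (n - 1)) * (H τ / (2 * ‖‖x‖ - τ‖ₑ) ^ β)) *
          (c * ENNReal.ofReal (δ ^ (n - 1))) := by ring
    _ ≤ (ENNReal.ofReal (τ ^ (n - 1)) * (H τ / (2 * ‖‖x‖ - τ‖ₑ) ^ β)) *
          μ.toSphere (ball ω δ) := mul_le_mul' le_rfl (le_toSphere_ball μ hδ hδ1 ω)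
    _ = ∫⁻ _ in ball ω δ, (ENNReal.ofReal (τ ^ (n - 1)) *
          (H τ / (2 * ‖‖x‖ - τ‖ₑ) ^ β)) ∂μ.toSphere := (setLIntegral_const _ _).symm
    _ ≤ ∫⁻ θ in ball ω δ, (ENNReal.ofReal (τ ^ (n - 1)) *
          (H ‖τ • (θ : E)‖ / ‖x - τ • (θ : E)‖ₑ ^ β)) ∂μ.toSphere := by
        refine setLIntegral_mono' measurableSet_ball fun θ hθ => ?_
        have h0 : ‖τ • (θ : E)‖ = τ := by simp [norm_smul, abs_of_pos hτ0]
        have h1 : ‖x - τ • (θ : E)‖ ≤ 2 * |‖x‖ - τ| := by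
          rw [mem_ball, Subtype.dist_eq, dist_eq_norm, norm_sub_rev] at hθ
          calc ‖x - τ • (θ : E)‖ = ‖‖x‖ • ((ω : E) - θ) + (‖x‖ - τ) • (θ : E)‖ := by
                rw [smul_sub, ← hω, sub_smul, sub_add_sub_cancel]
            _ ≤ ‖x‖ * ‖(ω : E) - θ‖ + |‖x‖ - τ| := by
                refine (norm_add_le _ _).trans_eq ?_
                simp [norm_smul]
            _ ≤ ‖x‖ * δ + |‖x‖ - τ| := by gcongr
            _ ≤ _ := by linarith
        rw [h0]
        gcongr
        calc ‖x - τ • (θ : E)‖ₑ = ENNReal.ofReal ‖x - τ • (θ : E)‖ := (ofReal_norm _).symm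
          _ ≤ ENNReal.ofReal (2 * |‖x‖ - τ|) := ENNReal.ofReal_le_ofReal h1
          _ = 2 * ‖‖x‖ - τ‖ₑ := by
            rw [ENNReal.ofReal_mul (by norm_num), ← Real.norm_eq_abs, ofReal_norm]
            simp
    _ ≤ _ := setLIntegral_le_lintegral _ _

/-- Since ρτ / max(ρ, τ) = min(ρ, τ) ≥ a, the two Jacobians and the cap factor together dominate (a
|ρ - τ|)^(n-1). The power of |ρ - τ| lowers the kernel exponent from n + γ to 1 + γ. -/
theorem radial_weight_le {a ρ τ γ : ℝ} {n : ℕ} (hn : 0 < n) (ha : 0 < a) (hρ : a ≤ ρ) (hτ : a ≤ τ)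
    (hne : ρ ≠ τ) (hγ : 0 < γ) (H : ℝ≥0∞) :
    ENNReal.ofReal (a ^ (n - 1)) * (H / ‖ρ - τ‖ₑ ^ (1 + γ)) ≤
      2 ^ (n + γ) * (ENNReal.ofReal (ρ ^ (n - 1)) * (ENNReal.ofReal (τ ^ (n - 1)) *
        (ENNReal.ofReal ((|ρ - τ| / max ρ τ) ^ (n - 1)) * (H / (2 * ‖ρ - τ‖ₑ) ^ (n + γ))))) := by
  have hρ0 : 0 < ρ := ha.trans_le hρ
  have hτ0 : 0 < τ := ha.trans_le hτ
  have hmax : 0 < max ρ τ := lt_max_of_lt_left hρ0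
  have hd : ‖ρ - τ‖ₑ ≠ 0 := by simpa [sub_eq_zero] using hne
  have hdt : ‖ρ - τ‖ₑ ≠ ∞ := enorm_ne_top
  set D := ‖ρ - τ‖ₑ
  have h2 : (2 : ℝ≥0∞) ^ (n + γ) ≠ 0 := by simp
  have h2t : (2 : ℝ≥0∞) ^ (n + γ) ≠ ∞ := by
    exact ENNReal.rpow_ne_top_of_nonneg (by positivity) (by norm_num)
  have hDpow : D ^ (n + γ) = D ^ (n - 1) * D ^ (1 + γ) := by
    rw [← ENNReal.rpow_natCast, ← ENNReal.rpow_add _ _ hd hdt, Nat.cast_sub hn]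
    congr 1
    push_cast
    ring
  have hD : D = ENNReal.ofReal |ρ - τ| := by rw [← Real.norm_eq_abs, ofReal_norm]
  have hw : ENNReal.ofReal (a ^ (n - 1)) * D ^ (n - 1) ≤ ENNReal.ofReal (ρ ^ (n - 1)) *
      ENNReal.ofReal (τ ^ (n - 1)) * ENNReal.ofReal ((|ρ - τ| / max ρ τ) ^ (n - 1)) := by
    rw [hD, ← ENNReal.ofReal_pow (abs_nonneg _), ← ENNReal.ofReal_mul (by positivity),
      ← ENNReal.ofReal_mul (by positivity), ← ENNReal.ofReal_mul (by positivity), ← mul_pow,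
      ← mul_pow, ← mul_pow]
    refine ENNReal.ofReal_le_ofReal (pow_le_pow_left₀ (by positivity) ?_ _)
    rw [mul_div_assoc', le_div_iff₀ hmax, ← max_mul_min ρ τ]
    have := mul_le_mul_of_nonneg_left (le_min hρ hτ) (mul_nonneg (abs_nonneg (ρ - τ)) hmax.le)
    linarith
  calc ENNReal.ofReal (a ^ (n - 1)) * (H / D ^ (1 + γ))
      = (ENNReal.ofReal (a ^ (n - 1)) * D ^ (n - 1)) * (H / D ^ (n + γ)) := by
        have hq : D ^ (n - 1) ≠ 0 := pow_ne_zero _ hd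
        have hq' : D ^ (n - 1) ≠ ∞ := ENNReal.pow_ne_top hdt
        rw [hDpow, div_eq_mul_inv, div_eq_mul_inv, ENNReal.mul_inv (Or.inl hq) (Or.inl hq')]
        calc _ = ENNReal.ofReal (a ^ (n - 1)) * (H * (D ^ (1 + γ))⁻¹) *
              (D ^ (n - 1) * (D ^ (n - 1))⁻¹) := by
              rw [ENNReal.mul_inv_cancel hq hq', mul_one]
          _ = _ := by ring
    _ ≤ (ENNReal.ofReal (ρ ^ (n - 1)) *
      ENNReal.ofReal (τ ^ (n - 1)) * ENNReal.ofReal ((|ρ - τ| / max ρ τ) ^ (n - 1))) *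
        (H / D ^ (n + γ)) := mul_le_mul' hw le_rfl
    _ = _ := by
        rw [ENNReal.mul_rpow_of_nonneg _ _ (by positivity), div_eq_mul_inv H, div_eq_mul_inv H,
          ENNReal.mul_inv (Or.inl h2) (Or.inl h2t)]
        calc _ = ENNReal.ofReal (ρ ^ (n - 1)) * ENNReal.ofReal (τ ^ (n - 1)) *
              ENNReal.ofReal ((|ρ - τ| / max ρ τ) ^ (n - 1)) * (H * (D ^ (n + γ))⁻¹) *
              (2 ^ (n + γ) * (2 ^ (n + γ))⁻¹) := by
              rw [ENNReal.mul_inv_cancel h2 h2t, mul_one]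
          _ = _ := by ring

/-- The one-dimensional Gagliardo energy of the profile of a radial function is controlled by the
energy of the function. -/
theorem exists_radial_energy_le {p γ : ℝ} (hγ : 0 < γ) :
    ∃ C : ℝ≥0∞, C ≠ ∞ ∧ ∀ f : ℝ → ℝ, Measurable f → ∀ a : ℝ, 0 < a → ∀ I : Set ℝ,
      MeasurableSet I → I ⊆ Ici a →
      ENNReal.ofReal (a ^ (Module.finrank ℝ E - 1)) *
        (∫⁻ ρ in I, ∫⁻ τ in I, ‖f ρ - f τ‖ₑ ^ p / ‖ρ - τ‖ₑ ^ (1 + γ)) ≤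
      C * ∫⁻ x in norm ⁻¹' I, (∫⁻ y in norm ⁻¹' I,
        ‖f ‖x‖ - f ‖y‖‖ₑ ^ p / ‖x - y‖ₑ ^ (Module.finrank ℝ E + γ) ∂μ) ∂μ := by
  set n := Module.finrank ℝ E with hn
  have hnpos : 0 < n := Module.finrank_pos
  set c := μ (ball 0 1) / 8 ^ n with hc
  have hc0 : c ≠ 0 := by
    have : μ (ball 0 1) ≠ 0 := (measure_ball_pos μ 0 one_pos).ne'
    simp [hc, this]
  have hct : c ≠ ∞ := ENNReal.div_ne_top measure_ball_lt_top.ne (by simp)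
  have hσ0 : μ.toSphere univ ≠ 0 := Measure.measure_univ_ne_zero.2 (Measure.toSphere_ne_zero μ)
  have hσt : μ.toSphere univ ≠ ∞ := measure_ne_top _ _
  refine ⟨2 ^ (n + γ) * (c⁻¹ * (μ.toSphere univ)⁻¹), ENNReal.mul_ne_top
    (ENNReal.rpow_ne_top_of_nonneg (by positivity) (by norm_num))
    (ENNReal.mul_ne_top (ENNReal.inv_ne_top.2 hc0) (ENNReal.inv_ne_top.2 hσ0)), ?_⟩
  intro f hf a ha I hI hIa
  -- the kernel integrated over spheres
  let Φ : ℝ → ℝ≥0∞ := fun ρ => ∫⁻ τ in I, ENNReal.ofReal (τ ^ (n - 1)) *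
    (ENNReal.ofReal ((|ρ - τ| / max ρ τ) ^ (n - 1)) *
      (‖f ρ - f τ‖ₑ ^ p / (2 * ‖ρ - τ‖ₑ) ^ (n + γ)))
  have hΦ : Measurable Φ := by
    refine Measurable.lintegral_prod_right' (f := fun q : ℝ × ℝ => ENNReal.ofReal (q.2 ^ (n - 1)) *
      (ENNReal.ofReal ((|q.1 - q.2| / max q.1 q.2) ^ (n - 1)) *
      (‖f q.1 - f q.2‖ₑ ^ p / (2 * ‖q.1 - q.2‖ₑ) ^ (n + γ)))) ?_
    fun_prop
  have hI0 : I ⊆ Ioi 0 := fun t ht => ha.trans_le (hIa ht)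
  have hIn : MeasurableSet (norm ⁻¹' I : Set E) := measurable_norm hI
  have inner : ∀ x ∈ (norm ⁻¹' I : Set E), c * Φ ‖x‖ ≤ ∫⁻ y in norm ⁻¹' I,
        ‖f ‖x‖ - f ‖y‖‖ₑ ^ p / ‖x - y‖ₑ ^ (n + γ) ∂μ := by
    intro x hx
    have hx0 : x ≠ 0 := norm_pos_iff.1 (hI0 hx)
    -- The restriction to radii in I is carried by H, so that the full-space kernel bound applies.
    have := lintegral_radial_kernel_le μ (H := I.indicator fun τ => ‖f ‖x‖ - f τ‖ₑ ^ p)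
      (Measurable.indicator (by fun_prop) hI) (β := n + γ) (by positivity) hx0
    convert this using 1
    · congr 1
      simp only [Φ]
      rw [← lintegral_indicator hI, ← lintegral_indicator measurableSet_Ioi]
      refine lintegral_congr fun τ => ?_
      by_cases hτ : τ ∈ I
      · rw [indicator_of_mem hτ, indicator_of_mem (hI0 hτ), indicator_of_mem hτ]
      · rw [indicator_of_notMem hτ]
        by_cases hτ0 : τ ∈ Ioi (0 : ℝ)
        · rw [indicator_of_mem hτ0, indicator_of_notMem hτ]
          simp
        · rw [indicator_of_notMem hτ0]
    · rw [← lintegral_indicator hIn]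
      refine lintegral_congr fun y => ?_
      by_cases hy : ‖y‖ ∈ I
      · rw [indicator_of_mem (by exact hy), indicator_of_mem hy]
      · rw [indicator_of_notMem (by exact hy), indicator_of_notMem hy]
        simp
  have outer : c * (μ.toSphere univ * ∫⁻ ρ in I, ENNReal.ofReal (ρ ^ (n - 1)) * Φ ρ) ≤
      ∫⁻ x in norm ⁻¹' I, (∫⁻ y in norm ⁻¹' I,
        ‖f ‖x‖ - f ‖y‖‖ₑ ^ p / ‖x - y‖ₑ ^ (n + γ) ∂μ) ∂μ := by
    refine le_trans (le_of_eq ?_) (setLIntegral_mono' hIn inner)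
    rw [lintegral_const_mul _ (by fun_prop)]
    congr 1
    have := lintegral_fun_norm μ (F := I.indicator Φ) (hΦ.indicator hI)
    rw [← lintegral_indicator hIn]
    trans ∫⁻ x, I.indicator Φ ‖x‖ ∂μ
    · rw [this, ← lintegral_indicator hI, ← lintegral_indicator measurableSet_Ioi]
      congr 1
      refine lintegral_congr fun τ => ?_
      by_cases hτ : τ ∈ I
      · rw [indicator_of_mem hτ, indicator_of_mem (hI0 hτ), indicator_of_mem hτ]
      · rw [indicator_of_notMem hτ]
        by_cases hτ0 : τ ∈ Ioi (0 : ℝ)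
        · rw [indicator_of_mem hτ0, indicator_of_notMem hτ, mul_zero]
        · rw [indicator_of_notMem hτ0]
    · rfl
  have low : ENNReal.ofReal (a ^ (n - 1)) *
        (∫⁻ ρ in I, ∫⁻ τ in I, ‖f ρ - f τ‖ₑ ^ p / ‖ρ - τ‖ₑ ^ (1 + γ)) ≤
      2 ^ (n + γ) * ∫⁻ ρ in I, ENNReal.ofReal (ρ ^ (n - 1)) * Φ ρ := by
    rw [← lintegral_const_mul' _ _ ENNReal.ofReal_ne_top, ← lintegral_const_mul _ (by fun_prop)]
    refine setLIntegral_mono' hI fun ρ hρ => ?_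
    rw [← lintegral_const_mul' _ _ ENNReal.ofReal_ne_top,
      ← lintegral_const_mul' _ _ ENNReal.ofReal_ne_top, ← lintegral_const_mul _ (by fun_prop)]
    refine lintegral_mono_ae ?_
    have hne : ∀ᵐ τ ∂volume.restrict I, τ ≠ ρ := ae_restrict_of_ae (Measure.ae_ne volume ρ)
    filter_upwards [hne, ae_restrict_mem hI] with τ hτ hτI
    exact radial_weight_le hnpos ha (hIa hρ) (hIa hτI) hτ.symm hγ _
  refine low.trans ?_
  rw [mul_assoc]
  gcongr
  calc _ = c⁻¹ * (μ.toSphere univ)⁻¹ *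
        (c * (μ.toSphere univ * ∫⁻ ρ in I, ENNReal.ofReal (ρ ^ (n - 1)) * Φ ρ)) := by
        calc _ = (c⁻¹ * c) * ((μ.toSphere univ)⁻¹ * μ.toSphere univ) *
              ∫⁻ ρ in I, ENNReal.ofReal (ρ ^ (n - 1)) * Φ ρ := by
              rw [ENNReal.inv_mul_cancel hc0 hct, ENNReal.inv_mul_cancel hσ0 hσt, one_mul, one_mul]
          _ = _ := by ring
    _ ≤ _ := mul_le_mul' le_rfl outer

end RadialKernel

/-! ### A Gagliardo–Nirenberg inequality by averaging over balls. -/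

section Sobolev

open Metric Set Filter Topology

theorem rpow_setLAverage_le {X : Type*} [MeasurableSpace X] {μ : Measure X} {A : Set X}
    (h0 : μ A ≠ 0) (ht : μ A ≠ ∞) {F : X → ℝ≥0∞} (hF : Measurable F) {p : ℝ} (hp : 1 ≤ p) :
    ((μ A)⁻¹ * ∫⁻ y in A, F y ∂μ) ^ p ≤ (μ A)⁻¹ * ∫⁻ y in A, F y ^ p ∂μ := by
  have hp0 : 0 < p := by linarith
  have : IsProbabilityMeasure ((μ A)⁻¹ • μ.restrict A) :=
    ⟨by simp [ENNReal.inv_mul_cancel h0 ht]⟩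
  have := eLpNorm'_le_eLpNorm'_of_exponent_le one_pos hp ((μ A)⁻¹ • μ.restrict A)
    hF.aestronglyMeasurable
  simp only [eLpNorm', enorm_eq_self, ENNReal.rpow_one, lintegral_smul_measure, smul_eq_mul,
    div_one] at this
  calc _ ≤ (((μ A)⁻¹ * ∫⁻ y in A, F y ^ p ∂μ) ^ (1 / p)) ^ p := by gcongr
    _ = _ := by rw [← ENNReal.rpow_mul, one_div_mul_cancel hp0.ne', ENNReal.rpow_one]

/-- The choice h = (m/g)^(1/(s+r)) balances the two terms: h^s g and h^(-r) m both become
m^(s/(s+r)) g^(r/(s+r)). Raising to the power 1 + s/r makes the bound linear in g. -/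
theorem ENNReal.rpow_le_of_forall_le_add {X A B g m : ℝ≥0∞} {s r : ℝ} (hs : 0 < s) (hr : 0 < r)
    (hB : B ≠ ∞) (hm0 : m ≠ 0) (hmt : m ≠ ∞) (hA : A + B ≠ 0)
    (hX : ∀ h : ℝ≥0∞, h ≠ 0 → h ≠ ∞ → X ≤ A * (h ^ s * g) + B * (h ^ (-r) * m)) :
    X ^ (1 + s / r) ≤ (A + B) ^ (1 + s / r) * (g * m ^ (s / r)) := by
  have hexp : 0 < 1 + s / r := by positivity
  by_cases hg0 : g = 0
  -- For g = 0 no balancing is possible, but only the second term remains, and h = n^(1/r) with n →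
  -- ∞ sends it to zero.
  · have hX0 : X ≤ 0 := by
      have hlim : Tendsto (fun n : ℕ => B * m * ((n : ℝ≥0∞))⁻¹) atTop (𝓝 (B * m * 0)) :=
        ENNReal.Tendsto.const_mul ENNReal.tendsto_inv_nat_nhds_zero
          (Or.inr (ENNReal.mul_ne_top hB hmt))
      rw [mul_zero] at hlim
      refine ge_of_tendsto hlim ?_
      filter_upwards [eventually_gt_atTop 0] with n hn
      have hn0 : (n : ℝ≥0∞) ≠ 0 := by exact_mod_cast hn.ne'
      have := hX ((n : ℝ≥0∞) ^ (1 / r)) (by simp [hn0])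
        (ENNReal.rpow_ne_top_of_nonneg (by positivity) (by simp))
      rw [← ENNReal.rpow_mul (n : ℝ≥0∞) (1 / r) (-r), hg0, mul_zero, mul_zero, zero_add,
        show 1 / r * -r = -1 by field_simp, ENNReal.rpow_neg_one] at this
      calc X ≤ _ := this
        _ = _ := by ring
    rw [nonpos_iff_eq_zero.1 hX0, ENNReal.zero_rpow_of_pos hexp]
    exact zero_le
  by_cases hgt : g = ∞
  · have h1 : m ^ (s / r) ≠ 0 := by simp [hm0, hmt]
    have h2 : (A + B) ^ (1 + s / r) ≠ 0 := by simp [hA, hexp.le]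
    rw [hgt, ENNReal.top_mul h1, ENNReal.mul_top h2]
    exact le_top
  have hsr : 0 < s + r := by positivity
  have hq0 : m / g ≠ 0 := ENNReal.div_ne_zero.2 ⟨hm0, hgt⟩
  have hqt : m / g ≠ ∞ := ENNReal.div_ne_top hmt hg0
  have key := hX ((m / g) ^ (1 / (s + r))) (by simp [hq0, hqt])
    (by simp [hq0, hqt])
  have e1 : ((m / g) ^ (1 / (s + r))) ^ s * g = m ^ (s / (s + r)) * g ^ (r / (s + r)) := by
    rw [← ENNReal.rpow_mul, ENNReal.div_rpow_of_nonneg _ _ (by positivity), div_eq_mul_inv,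
      ← ENNReal.rpow_neg, mul_assoc]
    nth_rewrite 2 [← ENNReal.rpow_one g]
    rw [← ENNReal.rpow_add _ _ hg0 hgt]
    congr 2
    · field_simp
    · field_simp
      ring
  have e2 : ((m / g) ^ (1 / (s + r))) ^ (-r) * m = m ^ (s / (s + r)) * g ^ (r / (s + r)) := by
    rw [← ENNReal.rpow_mul, show 1 / (s + r) * -r = - (r / (s + r)) by ring, ENNReal.rpow_neg,
      ← ENNReal.inv_rpow, ENNReal.inv_div (Or.inl hgt) (Or.inl hg0),
      ENNReal.div_rpow_of_nonneg _ _ (by positivity), div_eq_mul_inv, ← ENNReal.rpow_neg,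
      mul_assoc, mul_comm]
    nth_rewrite 2 [← ENNReal.rpow_one m]
    rw [← ENNReal.rpow_add _ _ hm0 hmt]
    congr 2
    field_simp
    ring
  rw [e1, e2, ← add_mul] at key
  calc X ^ (1 + s / r) ≤ ((A + B) * (m ^ (s / (s + r)) * g ^ (r / (s + r)))) ^ (1 + s / r) := by
        gcongr
    _ = _ := by
        rw [ENNReal.mul_rpow_of_nonneg _ _ hexp.le, ENNReal.mul_rpow_of_nonneg _ _ hexp.le,
          ← ENNReal.rpow_mul, ← ENNReal.rpow_mul,
          show s / (s + r) * (1 + s / r) = s / r by field_simp; ring,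
          show r / (s + r) * (1 + s / r) = 1 by field_simp; ring, ENNReal.rpow_one, mul_comm g]

variable {X : Type*} [NormedAddCommGroup X] [MeasurableSpace X] [BorelSpace X]
  [SecondCountableTopology X]

/-- Averaging |f(x)| ≤ |f(x) - f(y)| + |f(y)| over y in the ball of radius h, Jensen's inequality is
applied with exponent p to the first term and t to the second. In the ball the kernel is at least
h^(-(d+sp)), while the average costs at most 1/(κ h^d); this leaves the powers h^s and h^(-d/t). -/
theorem enorm_le_gagliardo_density_add {μ : Measure X} {κ : ℝ≥0∞} (hκ0 : κ ≠ 0)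
    (hκt : κ ≠ ∞) {d p s t : ℝ} (hd : 0 < d) (hp : 1 ≤ p) (hs : 0 < s) (ht : 1 ≤ t)
    {f : X → ℝ} (hf : Measurable f) {x : X} {h : ℝ} (hh : 0 < h)
    (hle : κ * ENNReal.ofReal h ^ d ≤ μ (ball x h)) (hfin : μ (ball x h) ≠ ∞) :
    ‖f x‖ₑ ≤ κ⁻¹ ^ (1 / p) * (ENNReal.ofReal h ^ s *
        (∫⁻ y, ‖f x - f y‖ₑ ^ p / ‖x - y‖ₑ ^ (d + s * p) ∂μ) ^ (1 / p)) +
      κ⁻¹ ^ (1 / t) * (ENNReal.ofReal h ^ (-(d / t)) * (∫⁻ y, ‖f y‖ₑ ^ t ∂μ) ^ (1 / t)) := by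
  set A := ball x h with hA
  set k := ENNReal.ofReal h with hk
  set G := ∫⁻ y, ‖f x - f y‖ₑ ^ p / ‖x - y‖ₑ ^ (d + s * p) ∂μ
  set M := ∫⁻ y, ‖f y‖ₑ ^ t ∂μ
  have hp0 : 0 < p := by linarith
  have ht0 : 0 < t := by linarith
  have hk0 : k ≠ 0 := by simpa [hk] using hh
  have hkt : k ≠ ∞ := ENNReal.ofReal_ne_top
  have hkd0 : k ^ d ≠ 0 := by simp [hk0, hkt]
  have hkdt : k ^ d ≠ ∞ := by simp [hk0, hkt]
  have h0 : μ A ≠ 0 := fun h => by simp [h, hκ0, hkd0] at hle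
  have hinv : (μ A)⁻¹ ≤ κ⁻¹ * (k ^ d)⁻¹ := by
    rw [← ENNReal.mul_inv (Or.inl hκ0) (Or.inl hκt)]
    exact ENNReal.inv_le_inv.2 hle
  have root : ∀ {Y Z : ℝ≥0∞} {q : ℝ}, 0 < q → Y ^ q ≤ Z → Y ≤ Z ^ (1 / q) := by
    intro Y Z q hq h
    rwa [one_div, ENNReal.le_rpow_inv_iff hq]
  have hsplit : ‖f x‖ₑ ≤ (μ A)⁻¹ * (∫⁻ y in A, ‖f x - f y‖ₑ ∂μ) +
      (μ A)⁻¹ * ∫⁻ y in A, ‖f y‖ₑ ∂μ := by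
    rw [← mul_add, ← lintegral_add_left (by fun_prop)]
    calc ‖f x‖ₑ = (μ A)⁻¹ * ∫⁻ _ in A, ‖f x‖ₑ ∂μ := by
          rw [setLIntegral_const, mul_left_comm, ENNReal.inv_mul_cancel h0 hfin, mul_one]
      _ ≤ _ := by
          gcongr with y
          simpa using enorm_add_le (f x - f y) (f y)
  refine hsplit.trans (add_le_add ?_ ?_)
  · refine (root hp0 (rpow_setLAverage_le h0 hfin (by fun_prop) hp)).trans ?_
    have hint : ∫⁻ y in A, ‖f x - f y‖ₑ ^ p ∂μ ≤ k ^ (d + s * p) * G := by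
      rw [← lintegral_const_mul _ (by fun_prop)]
      refine (setLIntegral_mono' measurableSet_ball fun y hy => ?_).trans
        (setLIntegral_le_lintegral A _)
      by_cases hxy : x = y
      · simp [hxy, ENNReal.zero_rpow_of_pos hp0]
      have hxy0 : ‖x - y‖ₑ ≠ 0 := by simpa [sub_eq_zero] using hxy
      have hxyt : ‖x - y‖ₑ ≠ ∞ := enorm_ne_top
      have hle : ‖x - y‖ₑ ≤ k := by
        rw [← ofReal_norm]
        refine ENNReal.ofReal_le_ofReal ?_
        rw [mem_ball, dist_comm, dist_eq_norm] at hy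
        exact hy.le
      rw [← mul_div_assoc, ENNReal.le_div_iff_mul_le (by simp [hxy0, hxyt])
        (by simp [hxy0, hxyt]), mul_comm]
      gcongr
    calc ((μ A)⁻¹ * ∫⁻ y in A, ‖f x - f y‖ₑ ^ p ∂μ) ^ (1 / p)
        ≤ ((κ⁻¹ * (k ^ d)⁻¹) * (k ^ (d + s * p) * G)) ^ (1 / p) := by gcongr
      _ = (κ⁻¹ * (k ^ (s * p) * G)) ^ (1 / p) := by
          rw [ENNReal.rpow_add _ _ hk0 hkt]
          congr 1
          calc _ = κ⁻¹ * (((k ^ d)⁻¹ * k ^ d) * k ^ (s * p) * G) := by ring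
            _ = _ := by rw [ENNReal.inv_mul_cancel hkd0 hkdt, one_mul]
      _ = _ := by
          rw [ENNReal.mul_rpow_of_nonneg _ _ (by positivity),
            ENNReal.mul_rpow_of_nonneg _ _ (by positivity), ← ENNReal.rpow_mul k,
            mul_assoc s, mul_one_div_cancel hp0.ne', mul_one]
  · refine (root ht0 (rpow_setLAverage_le h0 hfin (by fun_prop) ht)).trans ?_
    calc ((μ A)⁻¹ * ∫⁻ y in A, ‖f y‖ₑ ^ t ∂μ) ^ (1 / t)
        ≤ ((κ⁻¹ * (k ^ d)⁻¹) * M) ^ (1 / t) := by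
          gcongr
          exact setLIntegral_le_lintegral A _
      _ = _ := by
          rw [mul_assoc, ENNReal.mul_rpow_of_nonneg _ _ (by positivity),
            ENNReal.mul_rpow_of_nonneg _ _ (by positivity), ← ENNReal.rpow_neg,
            ← ENNReal.rpow_mul k, neg_mul, mul_one_div]

/-- A fractional Sobolev (Gagliardo–Nirenberg) inequality on spaces whose balls of radius `h`
have measure at least `κ * h ^ d`. -/
theorem exists_sobolev_gagliardo (μ : Measure X) [SFinite μ] {κ : ℝ≥0∞} (hκ0 : κ ≠ 0)
    (hκt : κ ≠ ∞) {d p s t : ℝ} (hd : 0 < d) (hp : 1 ≤ p) (hs : 0 < s) (ht : 1 ≤ t)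
    (hμ : ∀ᵐ x ∂μ, ∀ h : ℝ, 0 < h →
      κ * ENNReal.ofReal h ^ d ≤ μ (ball x h) ∧ μ (ball x h) ≠ ∞) :
    ∃ C : ℝ≥0∞, C ≠ ∞ ∧ ∀ f : X → ℝ, Measurable f → ∫⁻ x, ‖f x‖ₑ ^ t ∂μ ≠ ∞ →
      ∫⁻ x, ‖f x‖ₑ ^ (p * (1 + s * t / d)) ∂μ ≤
        C * ((∫⁻ x, (∫⁻ y, ‖f x - f y‖ₑ ^ p / ‖x - y‖ₑ ^ (d + s * p) ∂μ) ∂μ) *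
          (∫⁻ x, ‖f x‖ₑ ^ t ∂μ) ^ (s * p / d)) := by
  have hp0 : 0 < p := by linarith
  have ht0 : 0 < t := by linarith
  have hκit : κ⁻¹ ≠ ∞ := ENNReal.inv_ne_top.2 hκ0
  have hexp : 0 < 1 + s * t / d := by positivity
  have hA0 : κ⁻¹ ^ (1 / p) ≠ 0 := by simp [hκ0, hκt]
  have hAt : κ⁻¹ ^ (1 / p) ≠ ∞ := ENNReal.rpow_ne_top_of_nonneg (by positivity) hκit
  have hBt : κ⁻¹ ^ (1 / t) ≠ ∞ := ENNReal.rpow_ne_top_of_nonneg (by positivity) hκit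
  refine ⟨((κ⁻¹ ^ (1 / p) + κ⁻¹ ^ (1 / t)) ^ (1 + s * t / d)) ^ p,
    ENNReal.rpow_ne_top_of_nonneg hp0.le (ENNReal.rpow_ne_top_of_nonneg hexp.le
      (ENNReal.add_ne_top.2 ⟨hAt, hBt⟩)), ?_⟩
  intro f hf hM
  by_cases hM0 : ∫⁻ x, ‖f x‖ₑ ^ t ∂μ = 0
  · have hz := (lintegral_eq_zero_iff (by fun_prop)).1 hM0
    rw [lintegral_congr_ae (g := fun _ => 0)]
    · simp
    · filter_upwards [hz] with x hx
      have : ‖f x‖ₑ = 0 := (ENNReal.rpow_eq_zero_iff_of_pos ht0).1 hx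
      rw [this, ENNReal.zero_rpow_of_pos (by positivity)]
  have hGm : Measurable fun x => ∫⁻ y, ‖f x - f y‖ₑ ^ p / ‖x - y‖ₑ ^ (d + s * p) ∂μ := by
    refine Measurable.lintegral_prod_right'
      (f := fun z : X × X => ‖f z.1 - f z.2‖ₑ ^ p / ‖z.1 - z.2‖ₑ ^ (d + s * p)) ?_
    fun_prop
  rw [← lintegral_mul_const _ hGm, ← lintegral_const_mul _ (hGm.mul_const _)]
  refine lintegral_mono_ae ?_
  filter_upwards [hμ] with x hx
  set G := ∫⁻ y, ‖f x - f y‖ₑ ^ p / ‖x - y‖ₑ ^ (d + s * p) ∂μ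
  set M := ∫⁻ y, ‖f y‖ₑ ^ t ∂μ
  -- The radius is optimized at each x separately, with r = d/t. The p-th power of the outcome is
  -- linear in the density G at x, so it integrates to the full energy.
  have key := ENNReal.rpow_le_of_forall_le_add (X := ‖f x‖ₑ) (A := κ⁻¹ ^ (1 / p))
    (B := κ⁻¹ ^ (1 / t)) (g := G ^ (1 / p)) (m := M ^ (1 / t)) hs (div_pos hd ht0) hBt
    (by simp [hM0, hM]) (by simp [hM0, hM]) (fun h => hA0 (add_eq_zero.1 h).1) (by
      intro h h0 ht
      have hpos : 0 < h.toReal := ENNReal.toReal_pos h0 ht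
      have := enorm_le_gagliardo_density_add hκ0 hκt hd hp hs ‹1 ≤ t› hf hpos
        (hx _ hpos).1 (hx _ hpos).2
      rwa [ENNReal.ofReal_toReal ht] at this)
  rw [show s / (d / t) = s * t / d by field_simp] at key
  calc ‖f x‖ₑ ^ (p * (1 + s * t / d)) = (‖f x‖ₑ ^ (1 + s * t / d)) ^ p := by
        rw [← ENNReal.rpow_mul, mul_comm]
    _ ≤ ((κ⁻¹ ^ (1 / p) + κ⁻¹ ^ (1 / t)) ^ (1 + s * t / d) *
          (G ^ (1 / p) * (M ^ (1 / t)) ^ (s * t / d))) ^ p := by gcongr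
    _ = _ := by
        rw [ENNReal.mul_rpow_of_nonneg _ _ hp0.le, ENNReal.mul_rpow_of_nonneg _ _ hp0.le,
          ← ENNReal.rpow_mul G, one_div_mul_cancel hp0.ne', ENNReal.rpow_one,
          ← ENNReal.rpow_mul M, ← ENNReal.rpow_mul M]
        congr 3
        field_simp

end Sobolev

/-! ### The one-dimensional Morrey inequality by Campanato telescoping. -/

section Morrey

open Metric Set Filter Topology

theorem enorm_sub_setAverage_le {X : Type*} [MeasurableSpace X] {μ : Measure X} {A : Set X}
    (h0 : μ A ≠ 0) (ht : μ A ≠ ∞) {f : X → ℝ} (hf : IntegrableOn f A μ) (c : ℝ) :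
    ‖c - ⨍ y in A, f y ∂μ‖ₑ ≤ (μ A)⁻¹ * ∫⁻ y in A, ‖c - f y‖ₑ ∂μ := by
  have : IsProbabilityMeasure ((μ A)⁻¹ • μ.restrict A) :=
    ⟨by simp [ENNReal.inv_mul_cancel h0 ht]⟩
  have hint : Integrable f ((μ A)⁻¹ • μ.restrict A) :=
    hf.smul_measure (ENNReal.inv_ne_top.2 h0)
  have e : c - ⨍ y in A, f y ∂μ = ∫ y, (c - f y) ∂((μ A)⁻¹ • μ.restrict A) := by
    rw [integral_sub (integrable_const c) hint, average_eq', Measure.restrict_apply_univ]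
    simp
  rw [e]
  refine (enorm_integral_le_lintegral_enorm _).trans_eq ?_
  rw [lintegral_smul_measure, smul_eq_mul]

/-- Jensen's inequality twice, once in each variable. -/
theorem rpow_enorm_setAverage_sub_le {X : Type*} [MeasurableSpace X] {μ : Measure X} [SFinite μ]
    {A B : Set X} (hA0 : μ A ≠ 0) (hAt : μ A ≠ ∞) (hB0 : μ B ≠ 0) (hBt : μ B ≠ ∞) {f : X → ℝ}
    (hf : Measurable f) (hfA : IntegrableOn f A μ) (hfB : IntegrableOn f B μ) {p : ℝ}
    (hp : 1 ≤ p) :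
    ‖(⨍ y in B, f y ∂μ) - ⨍ y in A, f y ∂μ‖ₑ ^ p ≤
      (μ A)⁻¹ * ((μ B)⁻¹ * ∫⁻ y in A, (∫⁻ z in B, ‖f y - f z‖ₑ ^ p ∂μ) ∂μ) := by
  have hp0 : 0 ≤ p := by linarith
  calc ‖(⨍ y in B, f y ∂μ) - ⨍ y in A, f y ∂μ‖ₑ ^ p
      ≤ ((μ A)⁻¹ * ∫⁻ y in A, ‖(⨍ z in B, f z ∂μ) - f y‖ₑ ∂μ) ^ p := by
        gcongr
        exact enorm_sub_setAverage_le hA0 hAt hfA _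
    _ ≤ (μ A)⁻¹ * ∫⁻ y in A, ‖(⨍ z in B, f z ∂μ) - f y‖ₑ ^ p ∂μ :=
        rpow_setLAverage_le hA0 hAt (by fun_prop) hp
    _ ≤ (μ A)⁻¹ * ∫⁻ y in A, ((μ B)⁻¹ * ∫⁻ z in B, ‖f y - f z‖ₑ ^ p ∂μ) ∂μ := by
        gcongr with y
        rw [enorm_sub_rev]
        refine (ENNReal.rpow_le_rpow (enorm_sub_setAverage_le hB0 hBt hfB _) hp0).trans ?_
        exact rpow_setLAverage_le hB0 hBt (by fun_prop) hp
    _ = _ := by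
        rw [lintegral_const_mul]
        refine Measurable.lintegral_prod_right' (f := fun z : X × X => ‖f z.1 - f z.2‖ₑ ^ p) ?_
        fun_prop

/-- If `‖x - y‖ ≤ η` then `‖f x - f y‖ ^ p` is at most `η ^ (1 + γ)` times the Gagliardo kernel. -/
theorem rpow_enorm_sub_le_mul_kernel {f : ℝ → ℝ} {p γ : ℝ} (hp : 0 < p) (hγ : 0 < γ) {x y : ℝ}
    {η : ℝ≥0∞} (h : ‖x - y‖ₑ ≤ η) :
    ‖f x - f y‖ₑ ^ p ≤ η ^ (1 + γ) * (‖f x - f y‖ₑ ^ p / ‖x - y‖ₑ ^ (1 + γ)) := by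
  by_cases hxy : x = y
  · simp [hxy, ENNReal.zero_rpow_of_pos hp]
  have hxy0 : ‖x - y‖ₑ ≠ 0 := by simpa [sub_eq_zero] using hxy
  have hxyt : ‖x - y‖ₑ ≠ ∞ := enorm_ne_top
  rw [← mul_div_assoc, ENNReal.le_div_iff_mul_le (by simp [hxy0, hxyt])
    (by simp [hxy0, hxyt]), mul_comm]
  gcongr

theorem integrableOn_of_gagliardo_density_ne_top {f : ℝ → ℝ} (hf : Measurable f) {p γ : ℝ}
    (hp : 1 ≤ p) (hγ : 0 < γ) {x : ℝ} {A : Set ℝ} (hA : MeasurableSet A) {η : ℝ≥0∞} (hη : η ≠ ∞)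
    (h0 : volume A ≠ 0) (ht : volume A ≠ ∞) (hx : ∀ y ∈ A, ‖x - y‖ₑ ≤ η)
    (hg : ∫⁻ y in A, ‖f x - f y‖ₑ ^ p / ‖x - y‖ₑ ^ (1 + γ) ≠ ∞) : IntegrableOn f A := by
  have hp0 : 0 < p := by linarith
  have h1 : ∫⁻ y in A, ‖f x - f y‖ₑ ^ p ≠ ∞ := by
    refine ne_top_of_le_ne_top (ENNReal.mul_ne_top (ENNReal.rpow_ne_top_of_nonneg
      (by positivity : 0 ≤ 1 + γ) hη) hg) ?_
    rw [← lintegral_const_mul _ (by fun_prop)]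
    exact setLIntegral_mono' hA fun y hy => rpow_enorm_sub_le_mul_kernel hp0 hγ (hx y hy)
  have h2 : ∫⁻ y in A, ‖f x - f y‖ₑ ≠ ∞ := by
    intro h
    have := rpow_setLAverage_le (μ := volume) h0 ht (F := fun y => ‖f x - f y‖ₑ) (by fun_prop) hp
    rw [h, ENNReal.mul_top (ENNReal.inv_ne_zero.2 ht), ENNReal.top_rpow_of_pos hp0] at this
    exact ENNReal.mul_ne_top (ENNReal.inv_ne_top.2 h0) h1 (top_le_iff.1 this)
  have h3 : IntegrableOn (fun y => f x - f y) A :=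
    ⟨by fun_prop, lt_top_iff_ne_top.2 h2⟩
  have h4 : IntegrableOn (fun _ => f x) A := integrableOn_const ht
  exact (Integrable.sub h4 h3).congr (ae_of_all _ fun y => by simp)

/-- Campanato-type estimate: the oscillation of `f` at `x` is bounded by the Gagliardo energy,
along a sequence of sets shrinking to `x`. -/
theorem enorm_sub_setAverage_le_gagliardo {f : ℝ → ℝ} (hf : Measurable f) {p γ : ℝ} (hp : 1 ≤ p)
    (hγ : 1 < γ) {x : ℝ} {A : ℕ → Set ℝ} (hA : ∀ k, MeasurableSet (A k)) (hanti : Antitone A)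
    {η : ℝ≥0∞} (hη0 : η ≠ 0) (hη : η ≠ ∞) (hvol : ∀ k, volume (A k) = η * 2⁻¹ ^ k)
    (hx : ∀ k, ∀ y ∈ A k, ‖x - y‖ₑ ≤ η * 2⁻¹ ^ k)
    (hdiam : ∀ k, ∀ y ∈ A k, ∀ z ∈ A k, ‖y - z‖ₑ ≤ η * 2⁻¹ ^ k)
    (hg : ∫⁻ y in A 0, ‖f x - f y‖ₑ ^ p / ‖x - y‖ₑ ^ (1 + γ) ≠ ∞) :
    ‖f x - ⨍ y in A 0, f y‖ₑ ≤ (2 ^ (1 / p) * (1 - 2⁻¹ ^ ((γ - 1) / p))⁻¹) *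
      (η ^ ((γ - 1) / p) *
      (∫⁻ y in A 0, ∫⁻ z in A 0, ‖f y - f z‖ₑ ^ p / ‖y - z‖ₑ ^ (1 + γ)) ^ (1 / p)) := by
  have hp0 : 0 < p := by linarith
  have hγ0 : 0 < γ := by linarith
  set D := ∫⁻ y in A 0, ∫⁻ z in A 0, ‖f y - f z‖ₑ ^ p / ‖y - z‖ₑ ^ (1 + γ) with hD
  set g := ∫⁻ y in A 0, ‖f x - f y‖ₑ ^ p / ‖x - y‖ₑ ^ (1 + γ) with hgdef
  have h2k0 : ∀ k : ℕ, (2⁻¹ : ℝ≥0∞) ^ k ≠ 0 := fun k => pow_ne_zero _ (by simp)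
  have h2kt : ∀ k : ℕ, (2⁻¹ : ℝ≥0∞) ^ k ≠ ∞ := fun k => ENNReal.pow_ne_top (by simp)
  have hv0 : ∀ k, volume (A k) ≠ 0 := fun k => by
    rw [hvol]; exact mul_ne_zero hη0 (h2k0 k)
  have hvt : ∀ k, volume (A k) ≠ ∞ := fun k => by
    rw [hvol]; exact ENNReal.mul_ne_top hη (h2kt k)
  have hsub : ∀ k, A k ⊆ A 0 := fun k => hanti (Nat.zero_le k)
  have hint0 : IntegrableOn f (A 0) :=
    integrableOn_of_gagliardo_density_ne_top hf hp hγ0 (hA 0)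
      (ENNReal.mul_ne_top hη (h2kt 0)) (hv0 0) (hvt 0) (hx 0) hg
  have hint : ∀ k, IntegrableOn f (A k) := fun k => hint0.mono_set (hsub k)
  have root : ∀ {Y Z : ℝ≥0∞}, Y ^ p ≤ Z → Y ≤ Z ^ (1 / p) := by
    intro Y Z h
    rwa [one_div, ENNReal.le_rpow_inv_iff hp0]
  have hpowk : ∀ (k : ℕ) (e : ℝ), 0 ≤ e → (η * 2⁻¹ ^ k) ^ e = η ^ e * (2⁻¹ ^ e) ^ k := by
    intro k e he
    rw [ENNReal.mul_rpow_of_nonneg _ _ he, ← ENNReal.rpow_natCast, ← ENNReal.rpow_natCast,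
      ← ENNReal.rpow_mul, ← ENNReal.rpow_mul, mul_comm e]
  -- Finiteness of the density g at x forces the averages to converge to f x itself, so no Lebesgue
  -- point argument is needed. The factor g appears only in this vanishing term, not in the final
  -- constant.
  have hpt : ∀ k, ‖f x - ⨍ y in A k, f y‖ₑ ≤
      η ^ (γ / p) * g ^ (1 / p) * (2⁻¹ ^ (γ / p)) ^ k := by
    intro k
    have h1 : ‖f x - ⨍ y in A k, f y‖ₑ ^ p ≤ (η * 2⁻¹ ^ k) ^ γ * g := by
      refine (ENNReal.rpow_le_rpow (enorm_sub_setAverage_le (hv0 k) (hvt k) (hint k) _)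
        hp0.le).trans ?_
      refine (rpow_setLAverage_le (hv0 k) (hvt k) (by fun_prop) hp).trans ?_
      have h2 : ∫⁻ y in A k, ‖f x - f y‖ₑ ^ p ≤ (η * 2⁻¹ ^ k) ^ (1 + γ) * g := by
        rw [hgdef, ← lintegral_const_mul _ (by fun_prop)]
        refine (setLIntegral_mono' (hA k) fun y hy =>
          rpow_enorm_sub_le_mul_kernel hp0 hγ0 (hx k y hy)).trans ?_
        exact lintegral_mono_set (hsub k)
      rw [← hvol] at h2 ⊢
      calc _ ≤ (volume (A k))⁻¹ * (volume (A k) ^ (1 + γ) * g) := by gcongr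
        _ = _ := by
          rw [ENNReal.rpow_add _ _ (hv0 k) (hvt k), ENNReal.rpow_one, mul_assoc, ← mul_assoc,
            ENNReal.inv_mul_cancel (hv0 k) (hvt k), one_mul]
    refine (root h1).trans_eq ?_
    rw [ENNReal.mul_rpow_of_nonneg _ _ (by positivity), ← ENNReal.rpow_mul, mul_one_div,
      hpowk _ _ (by positivity)]
    ring
  -- Two averages cost |A k|^(-2) up to the factor 2 = |A k| / |A (k+1)|, and the kernel returns |A
  -- k|^(1+γ). The resulting geometric series has ratio 2^(-(γ-1)/p), less than 1 because γ > 1.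
  have hstep : ∀ k, ‖(⨍ y in A (k + 1), f y) - ⨍ y in A k, f y‖ₑ ≤
      (2 ^ (1 / p) * (η ^ ((γ - 1) / p) * D ^ (1 / p))) * (2⁻¹ ^ ((γ - 1) / p)) ^ k := by
    intro k
    have h1 : ‖(⨍ y in A (k + 1), f y) - ⨍ y in A k, f y‖ₑ ^ p ≤
        2 * ((η * 2⁻¹ ^ k) ^ (γ - 1) * D) := by
      refine (rpow_enorm_setAverage_sub_le (hv0 k) (hvt k) (hv0 _) (hvt _) hf (hint k) (hint _)
        hp).trans ?_
      have h2 : ∫⁻ y in A k, ∫⁻ z in A (k + 1), ‖f y - f z‖ₑ ^ p ≤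
          volume (A k) ^ (1 + γ) * D := by
        have hm : Measurable fun y =>
            ∫⁻ z in A 0, ‖f y - f z‖ₑ ^ p / ‖y - z‖ₑ ^ (1 + γ) := by
          refine Measurable.lintegral_prod_right'
            (f := fun q : ℝ × ℝ => ‖f q.1 - f q.2‖ₑ ^ p / ‖q.1 - q.2‖ₑ ^ (1 + γ)) ?_
          fun_prop
        rw [hD, ← lintegral_const_mul _ hm]
        refine (setLIntegral_mono' (hA k) fun y hy => ?_).trans (lintegral_mono_set (hsub k))
        rw [← lintegral_const_mul _ (by fun_prop)]
        refine (setLIntegral_mono' (hA (k + 1)) fun z hz => ?_).trans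
          (lintegral_mono_set (hsub (k + 1)))
        rw [hvol]
        exact rpow_enorm_sub_le_mul_kernel hp0 hγ0
          (hdiam k y hy z (hanti (Nat.le_succ k) hz))
      have h3 : (volume (A (k + 1)))⁻¹ = 2 * (volume (A k))⁻¹ := by
        rw [hvol, hvol, pow_succ, ← mul_assoc, ENNReal.mul_inv (Or.inr (by simp))
          (Or.inr (by simp)), inv_inv, mul_comm]
      rw [h3, ← hvol]
      calc _ ≤ (volume (A k))⁻¹ * (2 * (volume (A k))⁻¹ * (volume (A k) ^ (1 + γ) * D)) := by
            gcongr
        _ = _ := by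
          rw [show 1 + γ = 1 + (1 + (γ - 1)) by ring, ENNReal.rpow_add _ _ (hv0 k) (hvt k),
            ENNReal.rpow_add _ _ (hv0 k) (hvt k), ENNReal.rpow_one]
          calc _ = 2 * (((volume (A k))⁻¹ * volume (A k)) * ((volume (A k))⁻¹ * volume (A k)) *
                volume (A k) ^ (γ - 1) * D) := by ring
            _ = _ := by rw [ENNReal.inv_mul_cancel (hv0 k) (hvt k), one_mul, one_mul]
    refine (root h1).trans_eq ?_
    rw [ENNReal.mul_rpow_of_nonneg _ _ (by positivity),
      ENNReal.mul_rpow_of_nonneg _ _ (by positivity), ← ENNReal.rpow_mul, mul_one_div,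
      hpowk _ _ (div_nonneg (by linarith) hp0.le)]
    ring
  set T := 2 ^ (1 / p) * (η ^ ((γ - 1) / p) * D ^ (1 / p)) with hT
  set q := (2⁻¹ : ℝ≥0∞) ^ ((γ - 1) / p) with hq
  have hsum : ∀ n, ‖f x - ⨍ y in A 0, f y‖ₑ ≤ ‖f x - ⨍ y in A n, f y‖ₑ +
      ∑ k ∈ Finset.range n, T * q ^ k := by
    intro n
    induction n with
    | zero => simp
    | succ n ih =>
      refine ih.trans ?_
      rw [Finset.sum_range_succ, add_comm _ (T * q ^ n), ← add_assoc]
      gcongr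
      calc ‖f x - ⨍ y in A n, f y‖ₑ = ‖(f x - ⨍ y in A (n + 1), f y) +
            ((⨍ y in A (n + 1), f y) - ⨍ y in A n, f y)‖ₑ := by rw [sub_add_sub_cancel]
        _ ≤ _ := (enorm_add_le _ _).trans (add_le_add le_rfl (hstep n))
  have hbound : ∀ n, ‖f x - ⨍ y in A 0, f y‖ₑ ≤
      η ^ (γ / p) * g ^ (1 / p) * (2⁻¹ ^ (γ / p)) ^ n + T * (1 - q)⁻¹ := by
    intro n
    refine (hsum n).trans (add_le_add (hpt n) ?_)
    rw [← Finset.mul_sum, ← ENNReal.tsum_geometric]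
    gcongr
    exact ENNReal.sum_le_tsum _
  have hlim : Tendsto (fun n : ℕ => η ^ (γ / p) * g ^ (1 / p) * (2⁻¹ ^ (γ / p)) ^ n +
      T * (1 - q)⁻¹) atTop (𝓝 (η ^ (γ / p) * g ^ (1 / p) * 0 + T * (1 - q)⁻¹)) := by
    refine Tendsto.add (ENNReal.Tendsto.const_mul ?_ (Or.inr ?_)) tendsto_const_nhds
    · refine ENNReal.tendsto_pow_atTop_nhds_zero_of_lt_one ?_
      exact ENNReal.rpow_lt_one (by simp) (by positivity)
    · exact ENNReal.mul_ne_top (ENNReal.rpow_ne_top_of_nonneg (by positivity) hη)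
        (ENNReal.rpow_ne_top_of_nonneg (by positivity) hg)
  rw [mul_zero, zero_add] at hlim
  refine (ge_of_tendsto' hlim hbound).trans_eq ?_
  rw [hT]
  ring

/-- The one-dimensional fractional Morrey inequality between two points at which the Gagliardo
density is finite. -/
theorem enorm_sub_le_gagliardo_Ioo {f : ℝ → ℝ} (hf : Measurable f) {p γ : ℝ} (hp : 1 ≤ p)
    (hγ : 1 < γ) {a b : ℝ} (hab : a < b)
    (ha : ∫⁻ y in Ioo a b, ‖f a - f y‖ₑ ^ p / ‖a - y‖ₑ ^ (1 + γ) ≠ ∞)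
    (hb : ∫⁻ y in Ioo a b, ‖f b - f y‖ₑ ^ p / ‖b - y‖ₑ ^ (1 + γ) ≠ ∞) :
    ‖f a - f b‖ₑ ≤ (2 * (2 ^ (1 / p) * (1 - 2⁻¹ ^ ((γ - 1) / p))⁻¹)) *
      (ENNReal.ofReal (b - a) ^ ((γ - 1) / p) *
      (∫⁻ y in Ioo a b, ∫⁻ z in Ioo a b,
        ‖f y - f z‖ₑ ^ p / ‖y - z‖ₑ ^ (1 + γ)) ^ (1 / p)) := by
  have hh : 0 < b - a := by linarith
  have hpow : ∀ k : ℕ, ENNReal.ofReal (b - a) * 2⁻¹ ^ k =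
      ENNReal.ofReal ((b - a) * 2⁻¹ ^ k) := by
    intro k
    rw [ENNReal.ofReal_mul hh.le, ENNReal.ofReal_pow (by norm_num),
      ENNReal.ofReal_inv_of_pos (by norm_num), ENNReal.ofReal_ofNat]
  have habs : ∀ {y z r : ℝ}, |y - z| ≤ r → ‖y - z‖ₑ ≤ ENNReal.ofReal r := by
    intro y z r h
    rw [← ofReal_norm, Real.norm_eq_abs]
    exact ENNReal.ofReal_le_ofReal h
  have hmono : ∀ {k l : ℕ}, k ≤ l → (b - a) * (2⁻¹ : ℝ) ^ l ≤ (b - a) * 2⁻¹ ^ k := by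
    intro k l hkl
    exact mul_le_mul_of_nonneg_left (pow_le_pow_of_le_one (by norm_num) (by norm_num) hkl) hh.le
  have hη0 : ENNReal.ofReal (b - a) ≠ 0 := by simpa using hab
  have h1 := enorm_sub_setAverage_le_gagliardo hf hp hγ (x := a)
    (A := fun k => Ioo a (a + (b - a) * 2⁻¹ ^ k)) (fun k => measurableSet_Ioo)
    (fun k l hkl => Ioo_subset_Ioo le_rfl (by linarith [hmono hkl]))
    (η := ENNReal.ofReal (b - a)) hη0 ENNReal.ofReal_ne_top
    (fun k => by rw [Real.volume_Ioo, hpow]; congr 1; ring)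
    (fun k y hy => by
      rw [hpow]; exact habs (abs_le.2 ⟨by linarith [hy.2], by linarith [hy.1, hy.2]⟩))
    (fun k y hy z hz => by
      rw [hpow]
      exact habs (abs_le.2 ⟨by linarith [hy.1, hz.2], by linarith [hy.2, hz.1]⟩))
    (by simpa using ha)
  have h2 := enorm_sub_setAverage_le_gagliardo hf hp hγ (x := b)
    (A := fun k => Ioo (b - (b - a) * 2⁻¹ ^ k) b) (fun k => measurableSet_Ioo)
    (fun k l hkl => Ioo_subset_Ioo (by linarith [hmono hkl]) le_rfl)
    (η := ENNReal.ofReal (b - a)) hη0 ENNReal.ofReal_ne_top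
    (fun k => by rw [Real.volume_Ioo, hpow]; congr 1; ring)
    (fun k y hy => by
      rw [hpow]; exact habs (abs_le.2 ⟨by linarith [hy.1, hy.2], by linarith [hy.1]⟩))
    (fun k y hy z hz => by
      rw [hpow]
      exact habs (abs_le.2 ⟨by linarith [hy.1, hz.2], by linarith [hy.2, hz.1]⟩))
    (by simpa using hb)
  simp only [pow_zero, mul_one, add_sub_cancel, sub_sub_cancel] at h1 h2
  rw [enorm_sub_rev] at h2
  calc ‖f a - f b‖ₑ = ‖(f a - ⨍ y in Ioo a b, f y) + ((⨍ y in Ioo a b, f y) - f b)‖ₑ := by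
        rw [sub_add_sub_cancel]
    _ ≤ _ := (enorm_add_le _ _).trans (add_le_add h1 h2)
    _ = _ := by ring

end Morrey

/-! ### Radial profiles, and Sobolev inequalities by absorption. -/

section Radial

open Metric Set Filter Topology

/-- `f` is a radial profile of `u`, vanishing on `[R, ∞)`. -/
structure IsRadialProfile {N : ℕ} (R : ℝ) (u : EuclideanSpace ℝ (Fin N) → ℝ) (f : ℝ → ℝ) :
    Prop where
  measurable : Measurable f
  eq_zero : ∀ r, R ≤ r → f r = 0
  ae_eq : u =ᵐ[volume] fun x => f ‖x‖

/-- Cutting the given profile off at R makes it vanish at every r ≥ R and not just almost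
everywhere, so it may be evaluated at chosen points there. -/
theorem MemD0Rad.exists_isRadialProfile {N : ℕ} {s p R : ℝ} {u : EuclideanSpace ℝ (Fin N) → ℝ}
    (hu : MemD0Rad s p R u) : ∃ f, IsRadialProfile R u f := by
  obtain ⟨h, f, hf, hfu⟩ := hu
  refine ⟨(Iio R).indicator f, hf.indicator measurableSet_Iio,
    fun r hr => indicator_of_notMem (by simpa using hr) _, ?_⟩
  filter_upwards [hfu, h.eq_zero] with x h1 h2
  by_cases hx : ‖x‖ < R
  · rw [indicator_of_mem (by exact hx), h1]
  · rw [indicator_of_notMem (by exact hx), h2 (by simpa using hx)]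

variable {N : ℕ}

theorem gagliardo_congr_ae {s p : ℝ} {Ω : Set (EuclideanSpace ℝ (Fin N))}
    {u v : EuclideanSpace ℝ (Fin N) → ℝ} (h : u =ᵐ[volume] v) :
    gagliardo s p Ω u = gagliardo s p Ω v := by
  unfold gagliardo
  congr 1
  refine lintegral_congr_ae (ae_restrict_of_ae ?_)
  filter_upwards [Measure.quasiMeasurePreserving_fst.ae h,
    Measure.quasiMeasurePreserving_snd.ae h] with z h1 h2
  rw [h1, h2]

theorem gagliardo_mono {s p : ℝ} (hp : 0 < p) {Ω Ω' : Set (EuclideanSpace ℝ (Fin N))}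
    (h : Ω ⊆ Ω') (u : EuclideanSpace ℝ (Fin N) → ℝ) : gagliardo s p Ω u ≤ gagliardo s p Ω' u :=
  ENNReal.rpow_le_rpow (lintegral_mono_set (prod_mono h h)) (by positivity)

theorem gagliardo_rpow {s p : ℝ} (hp : 0 < p) {Ω : Set (EuclideanSpace ℝ (Fin N))}
    {u : EuclideanSpace ℝ (Fin N) → ℝ} (hu : Measurable u) :
    gagliardo s p Ω u ^ p =
      ∫⁻ x in Ω, ∫⁻ y in Ω, ‖u x - u y‖ₑ ^ p / ‖x - y‖ₑ ^ ((N : ℝ) + s * p) := by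
  unfold gagliardo
  rw [← ENNReal.rpow_mul, one_div_mul_cancel hp.ne', ENNReal.rpow_one,
    ← Measure.prod_restrict, lintegral_prod _ (by fun_prop)]

/-- The constant is uniform in a, I and Ω. The explicit factor a^(N-1) supplies the decay weight in
the pointwise bound, and Ω is free because that bound uses both B_R and the whole space. -/
theorem exists_profile_energy_le (hN : 0 < N) {s p : ℝ} (hs : 0 < s) (hp : 0 < p) :
    ∃ C : ℝ≥0∞, C ≠ ∞ ∧ ∀ (R : ℝ) (u : EuclideanSpace ℝ (Fin N) → ℝ) (f : ℝ → ℝ),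
      IsRadialProfile R u f → ∀ a : ℝ, 0 < a → ∀ I : Set ℝ, MeasurableSet I → I ⊆ Ici a →
      ∀ Ω : Set (EuclideanSpace ℝ (Fin N)), norm ⁻¹' I ⊆ Ω →
      ENNReal.ofReal (a ^ (N - 1)) *
        (∫⁻ ρ in I, ∫⁻ τ in I, ‖f ρ - f τ‖ₑ ^ p / ‖ρ - τ‖ₑ ^ (1 + s * p)) ≤
      C * gagliardo s p Ω u ^ p := by
  have : Nonempty (Fin N) := ⟨⟨0, hN⟩⟩
  obtain ⟨C, hC, h⟩ := exists_radial_energy_le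
    (volume : Measure (EuclideanSpace ℝ (Fin N))) (p := p) (γ := s * p) (by positivity)
  refine ⟨C, hC, fun R u f hf a ha I hI hIa Ω hΩ => ?_⟩
  have hfm := hf.measurable
  have := h f hf.measurable a ha I hI hIa
  rw [finrank_euclideanSpace_fin] at this
  refine this.trans ?_
  rw [← gagliardo_rpow (u := fun x => f ‖x‖) hp (by fun_prop), ← gagliardo_congr_ae hf.ae_eq]
  gcongr
  exact gagliardo_mono hp hΩ u

/-- The absorption step: divide by Y^θ, which is legitimate only because Y is finite. -/
theorem ENNReal.le_rpow_of_le_mul_rpow {Y Z : ℝ≥0∞} {θ : ℝ} (hθ1 : θ < 1)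
    (hY : Y ≠ ∞) (h : Y ≤ Z * Y ^ θ) : Y ≤ Z ^ (1 / (1 - θ)) := by
  have h1 : 0 < 1 - θ := by linarith
  by_cases hY0 : Y = 0
  · simp [hY0]
  rw [one_div, ENNReal.le_rpow_inv_iff h1, ENNReal.rpow_sub _ _ hY0 hY, ENNReal.rpow_one]
  exact ENNReal.div_le_of_le_mul h

/-- The sharp fractional Sobolev inequality. -/
theorem exists_lintegral_rpow_le_gagliardo (hN : 0 < N) {s p : ℝ} (hs : 0 < s) (hp : 1 ≤ p)
    (hspN : s * p < N) :
    ∃ C : ℝ≥0∞, C ≠ ∞ ∧ ∀ u : EuclideanSpace ℝ (Fin N) → ℝ, Measurable u →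
      ∫⁻ x, ‖u x‖ₑ ^ ((N : ℝ) * p / (N - s * p)) ≠ ∞ →
      ∫⁻ x, ‖u x‖ₑ ^ ((N : ℝ) * p / (N - s * p)) ≤
        C * gagliardo s p univ u ^ ((N : ℝ) * p / (N - s * p)) := by
  have : Nonempty (Fin N) := ⟨⟨0, hN⟩⟩
  have hp0 : 0 < p := by linarith
  have hN0 : (0 : ℝ) < N := by exact_mod_cast hN
  have hd : 0 < (N : ℝ) - s * p := by linarith
  set q := (N : ℝ) * p / (N - s * p) with hq
  have hsp : 0 < s * p := by positivity
  have hqd : q * (N - s * p) = N * p := div_mul_cancel₀ _ hd.ne'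
  have hq1 : 1 ≤ q := by
    rw [hq, le_div_iff₀ hd]
    nlinarith [mul_le_mul_of_nonneg_left hp hN0.le]
  have hball : ∀ x : EuclideanSpace ℝ (Fin N), ∀ h : ℝ, 0 < h →
      volume (ball (0 : EuclideanSpace ℝ (Fin N)) 1) * ENNReal.ofReal h ^ (N : ℝ) ≤
        volume (ball x h) ∧ volume (ball x h) ≠ ∞ := by
    intro x h hh
    refine ⟨le_of_eq ?_, measure_ball_lt_top.ne⟩
    rw [Measure.addHaar_ball_of_pos _ _ hh, finrank_euclideanSpace_fin, ENNReal.rpow_natCast,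
      ENNReal.ofReal_pow hh.le, mul_comm]
  obtain ⟨C, hC, h⟩ := exists_sobolev_gagliardo (volume : Measure (EuclideanSpace ℝ (Fin N)))
    (measure_ball_pos _ 0 one_pos).ne' measure_ball_lt_top.ne hN0 hp hs hq1 (ae_of_all _ hball)
  have hθ : s * p / N < 1 := (div_lt_one hN0).2 hspN
  refine ⟨C ^ (1 / (1 - s * p / N)),
    ENNReal.rpow_ne_top_of_nonneg (one_div_nonneg.2 (by linarith)) hC, fun u hu hfin => ?_⟩
  have := h u hu hfin
  -- The critical q is the fixed point of t ↦ p(1 + st/N), so the same integral stands on both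
  -- sides, on the right with power sp/N < 1.
  rw [show p * (1 + s * q / N) = q by field_simp; linear_combination -hqd, ← mul_assoc] at this
  have hG := gagliardo_rpow (s := s) hp0 (Ω := univ) hu
  rw [Measure.restrict_univ] at hG
  rw [← hG] at this
  refine (ENNReal.le_rpow_of_le_mul_rpow hθ hfin this).trans_eq ?_
  rw [ENNReal.mul_rpow_of_nonneg _ _ (one_div_nonneg.2 (by linarith)), ← ENNReal.rpow_mul]
  congr 2
  rw [hq]
  field_simp

/-- For x > a the interval (x, x + h) stays in the half-line, so balls have measure at least h: d =
1 and κ = 1. -/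
theorem exists_sobolev_gagliardo_Ioi (a : ℝ) {s p t : ℝ} (hs : 0 < s) (hp : 1 ≤ p) (ht : 1 ≤ t) :
    ∃ C : ℝ≥0∞, C ≠ ∞ ∧ ∀ f : ℝ → ℝ, Measurable f → ∫⁻ x in Ioi a, ‖f x‖ₑ ^ t ≠ ∞ →
      ∫⁻ x in Ioi a, ‖f x‖ₑ ^ (p * (1 + s * t)) ≤
        C * ((∫⁻ x in Ioi a, ∫⁻ y in Ioi a, ‖f x - f y‖ₑ ^ p / ‖x - y‖ₑ ^ (1 + s * p)) *
          (∫⁻ x in Ioi a, ‖f x‖ₑ ^ t) ^ (s * p)) := by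
  have hμ : ∀ᵐ x ∂volume.restrict (Ioi a), ∀ h : ℝ, 0 < h →
      1 * ENNReal.ofReal h ^ (1 : ℝ) ≤ volume.restrict (Ioi a) (ball x h) ∧
        volume.restrict (Ioi a) (ball x h) ≠ ∞ := by
    filter_upwards [ae_restrict_mem measurableSet_Ioi] with x hx h hh
    refine ⟨?_, measure_ball_lt_top.ne⟩
    rw [Measure.restrict_apply measurableSet_ball, one_mul, ENNReal.rpow_one,
      show ENNReal.ofReal h = volume (Ioo x (x + h)) by rw [Real.volume_Ioo]; congr 1; ring]
    refine measure_mono fun y hy => ⟨?_, lt_trans hx hy.1⟩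
    rw [Real.ball_eq_Ioo]
    exact ⟨by linarith [hy.1], hy.2⟩
  obtain ⟨C, hC, h⟩ := exists_sobolev_gagliardo (volume.restrict (Ioi a)) one_ne_zero
    ENNReal.one_ne_top one_pos hp hs ht hμ
  exact ⟨C, hC, by simpa only [div_one] using h⟩

/-- One-dimensional critical Sobolev inequality on a half-line for functions that vanish near
infinity. -/
theorem exists_critical_sobolev_Ioi (a : ℝ) {s p : ℝ} (hs : 0 < s) (hp : 1 ≤ p)
    (hsp : s * p < 1) :
    ∃ C : ℝ≥0∞, C ≠ ∞ ∧ ∀ (R : ℝ) (f : ℝ → ℝ), Measurable f → (∀ r, R ≤ r → f r = 0) →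
      ∫⁻ x in Ioi a, ‖f x‖ₑ ^ (p / (1 - s * p)) ≤
        C * (∫⁻ x in Ioi a, ∫⁻ y in Ioi a,
          ‖f x - f y‖ₑ ^ p / ‖x - y‖ₑ ^ (1 + s * p)) ^ (1 / (1 - s * p)) := by
  have hp0 : 0 < p := by linarith
  have hd : 0 < 1 - s * p := by linarith
  have hspos : 0 < s * p := by positivity
  set q := p / (1 - s * p) with hq
  have hqd : q * (1 - s * p) = p := div_mul_cancel₀ _ hd.ne'
  have hq1 : 1 ≤ q := by rw [hq, le_div_iff₀ hd]; linarith
  have hq0 : 0 < q := by linarith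
  obtain ⟨C, hC, h⟩ := exists_sobolev_gagliardo_Ioi a hs hp hq1
  refine ⟨C ^ (1 / (1 - s * p)),
    ENNReal.rpow_ne_top_of_nonneg (one_div_nonneg.2 hd.le) hC, fun R f hf hR => ?_⟩
  set D := ∫⁻ x in Ioi a, ∫⁻ y in Ioi a, ‖f x - f y‖ₑ ^ p / ‖x - y‖ₑ ^ (1 + s * p) with hD
  -- Absorption needs a finite L^q integral, which is not known for f. Truncation at height n
  -- provides it, as f vanishes beyond R; it does not increase the energy, being 1-Lipschitz, and
  -- monotone convergence removes it.
  let T : ℕ → ℝ → ℝ := fun n r => max (-n) (min r n)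
  have hTabs : ∀ n r, |T n r| = min |r| n := by
    intro n r
    have hn : (0 : ℝ) ≤ n := n.cast_nonneg
    simp only [T]
    rcases le_total 0 r with h0 | h0
    · rw [max_eq_right (by linarith [le_min h0 hn]), abs_of_nonneg (le_min h0 hn),
        abs_of_nonneg h0]
    · rw [min_eq_left (h0.trans hn), abs_of_nonpos (max_le (by linarith) h0), abs_of_nonpos h0,
        ← min_neg_neg, neg_neg, min_comm]
  have hTlip : ∀ n x y, |T n x - T n y| ≤ |x - y| := by
    intro n x y
    exact (abs_max_sub_max_le_max _ _ _ _).trans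
      (max_le (by simp) ((abs_min_sub_min_le_max _ _ _ _).trans (max_le le_rfl (by simp))))
  have hTm : ∀ n, Measurable (T n) := fun n => by fun_prop
  have hfin : ∀ n, ∫⁻ x in Ioi a, ‖T n (f x)‖ₑ ^ q ≠ ∞ := by
    intro n
    have : ∫⁻ x in Ioi a, ‖T n (f x)‖ₑ ^ q ≤ ∫⁻ x in Ioo a R, (n : ℝ≥0∞) ^ q := by
      rw [← lintegral_indicator measurableSet_Ioi, ← lintegral_indicator measurableSet_Ioo]
      refine lintegral_mono fun x => ?_
      by_cases hx : x ∈ Ioi a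
      · rw [indicator_of_mem hx]
        by_cases hxR : x < R
        · rw [indicator_of_mem (by exact ⟨hx, hxR⟩)]
          gcongr
          rw [← ofReal_norm, Real.norm_eq_abs, hTabs, ← ENNReal.ofReal_natCast]
          exact ENNReal.ofReal_le_ofReal (min_le_right _ _)
        · rw [hR x (not_lt.1 hxR)]
          simp [T, hq0]
      · rw [indicator_of_notMem hx]
        exact zero_le
    refine ne_top_of_le_ne_top ?_ this
    rw [setLIntegral_const, Real.volume_Ioo]
    exact ENNReal.mul_ne_top (ENNReal.rpow_ne_top_of_nonneg hq0.le (by simp)) ENNReal.ofReal_ne_top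
  have hbd : ∀ n, ∫⁻ x in Ioi a, ‖T n (f x)‖ₑ ^ q ≤ (C * D) ^ (1 / (1 - s * p)) := by
    intro n
    have := h (fun x => T n (f x)) ((hTm n).comp hf) (hfin n)
    rw [show p * (1 + s * q) = q by linear_combination -hqd, ← mul_assoc] at this
    refine ENNReal.le_rpow_of_le_mul_rpow hsp (hfin n) (this.trans ?_)
    gcongr C * ?_ * _
    rw [hD]
    gcongr with x y
    simp only [← ofReal_norm, Real.norm_eq_abs]
    exact ENNReal.ofReal_le_ofReal (hTlip n _ _)
  rw [← ENNReal.mul_rpow_of_nonneg _ _ (one_div_nonneg.2 hd.le)]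
  have hsup : ∀ x, ‖f x‖ₑ ^ q = ⨆ n, ‖T n (f x)‖ₑ ^ q := by
    intro x
    refine le_antisymm ?_ (iSup_le fun n => ?_)
    · obtain ⟨n, hn⟩ := exists_nat_ge |f x|
      refine le_trans (le_of_eq ?_) (le_iSup _ n)
      congr 1
      rw [← ofReal_norm, ← ofReal_norm, Real.norm_eq_abs, Real.norm_eq_abs, hTabs, min_eq_left hn]
    · gcongr
      rw [← ofReal_norm, ← ofReal_norm, Real.norm_eq_abs, Real.norm_eq_abs, hTabs]
      exact ENNReal.ofReal_le_ofReal (min_le_left _ _)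
  simp only [hsup]
  rw [lintegral_iSup]
  · exact iSup_le hbd
  · intro n
    have := hTm n
    fun_prop
  · intro n m hnm x
    have : (n : ℝ) ≤ m := by exact_mod_cast hnm
    simp only
    gcongr
    rw [← ofReal_norm, ← ofReal_norm, Real.norm_eq_abs, Real.norm_eq_abs, hTabs, hTabs]
    exact ENNReal.ofReal_le_ofReal (min_le_min_left _ this)

end Radial

/-! ### Local L^q bounds for sp ≤ 1, and transfer between radii and space. -/

section Embedding

open Metric Set Filter Topology

variable {N : ℕ}

theorem CompactlyContained.exists_annulus {K : Set (EuclideanSpace ℝ (Fin N))}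
    (hK : CompactlyContained K {0}ᶜ) :
    ∃ a b : ℝ, 0 < a ∧ 0 < b ∧ ∀ x ∈ K, a < ‖x‖ ∧ ‖x‖ < b := by
  obtain ⟨-, hc, hsub⟩ := hK
  obtain ⟨b, hb0, hb⟩ := hc.isBounded.subset_ball_lt 0 0
  have h0 : (0 : EuclideanSpace ℝ (Fin N)) ∈ (closure K)ᶜ := fun h => hsub h rfl
  obtain ⟨ε, hε, h⟩ := Metric.isOpen_iff.1 isClosed_closure.isOpen_compl 0 h0
  refine ⟨ε / 2, b, by positivity, hb0, fun x hx => ⟨?_, ?_⟩⟩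
  · by_contra hcon
    have : x ∈ ball (0 : EuclideanSpace ℝ (Fin N)) ε := by
      rw [mem_ball_zero_iff]
      linarith
    exact h this (subset_closure hx)
  · simpa using hb (subset_closure hx)

theorem ae_norm_of_ae_Ioi (hN : 0 < N) {P : ℝ → Prop}
    (h : ∀ᵐ ρ ∂volume.restrict (Ioi (0 : ℝ)), P ρ) :
    ∀ᵐ x : EuclideanSpace ℝ (Fin N), P ‖x‖ := by
  have : Nonempty (Fin N) := ⟨⟨0, hN⟩⟩
  set S := toMeasurable (volume.restrict (Ioi (0 : ℝ))) {ρ | ¬ P ρ} with hS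
  have hSm : MeasurableSet S := measurableSet_toMeasurable _ _
  have hS0 : volume.restrict (Ioi (0 : ℝ)) S = 0 := by rw [hS, measure_toMeasurable]; exact h
  have hF : Measurable (S.indicator (1 : ℝ → ℝ≥0∞)) := measurable_one.indicator hSm
  have h1 := lintegral_fun_norm (volume : Measure (EuclideanSpace ℝ (Fin N))) hF
  have h2 : ∫⁻ r in Ioi (0 : ℝ), ENNReal.ofReal
      (r ^ (Module.finrank ℝ (EuclideanSpace ℝ (Fin N)) - 1)) * S.indicator 1 r = 0 := by
    rw [lintegral_eq_zero_iff (by fun_prop)]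
    have : ∀ᵐ ρ ∂volume.restrict (Ioi (0 : ℝ)), ρ ∉ S := measure_eq_zero_iff_ae_notMem.1 hS0
    filter_upwards [this] with ρ hρ
    simp [hρ]
  rw [h2, mul_zero, lintegral_eq_zero_iff (by fun_prop)] at h1
  filter_upwards [h1] with x hx
  by_contra hcon
  have : ‖x‖ ∈ S := subset_toMeasurable _ _ hcon
  simp [this] at hx

theorem exists_lintegral_norm_le (hN : 0 < N) {a b : ℝ} (ha : 0 < a) :
    ∃ C : ℝ≥0∞, C ≠ ∞ ∧ ∀ K : Set (EuclideanSpace ℝ (Fin N)), MeasurableSet K →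
      (∀ x ∈ K, a < ‖x‖ ∧ ‖x‖ < b) → ∀ F : ℝ → ℝ≥0∞, Measurable F →
      ∫⁻ x in K, F ‖x‖ ≤ C * ∫⁻ r in Ioi a, F r := by
  have : Nonempty (Fin N) := ⟨⟨0, hN⟩⟩
  set σ := (volume : Measure (EuclideanSpace ℝ (Fin N))).toSphere univ
  refine ⟨σ * ENNReal.ofReal (b ^ (N - 1)),
    ENNReal.mul_ne_top (measure_ne_top _ _) ENNReal.ofReal_ne_top, fun K hKm hK F hF => ?_⟩
  calc ∫⁻ x in K, F ‖x‖ ≤ ∫⁻ x : EuclideanSpace ℝ (Fin N), (Ioo a b).indicator F ‖x‖ := by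
        rw [← lintegral_indicator hKm]
        refine lintegral_mono fun x => ?_
        by_cases hx : x ∈ K
        · rw [indicator_of_mem hx, indicator_of_mem (by exact hK x hx)]
        · rw [indicator_of_notMem hx]
          exact zero_le
    _ = σ * ∫⁻ r in Ioi (0 : ℝ), ENNReal.ofReal (r ^ (N - 1)) * (Ioo a b).indicator F r := by
        rw [lintegral_fun_norm _ (hF.indicator measurableSet_Ioo), finrank_euclideanSpace_fin]
    _ ≤ σ * ∫⁻ r in Ioi a, ENNReal.ofReal (b ^ (N - 1)) * F r := by
        refine mul_le_mul' le_rfl ?_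
        rw [← lintegral_indicator measurableSet_Ioi, ← lintegral_indicator measurableSet_Ioi]
        refine lintegral_mono fun r => ?_
        by_cases hr : r ∈ Ioo a b
        · have hr0 : 0 < r := ha.trans hr.1
          rw [indicator_of_mem (by exact hr0), indicator_of_mem hr,
            indicator_of_mem (by exact hr.1)]
          gcongr
          exact hr.2.le
        · refine le_trans (le_of_eq ?_) zero_le
          simp [indicator_of_notMem hr]
    _ = _ := by rw [lintegral_const_mul _ hF, mul_assoc]

/-- On an annulus the Jacobian is bounded, so the L^q bound on the profile passes to K; Hölder's
inequality on K, of finite measure, lowers q to t. -/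
theorem exists_eLpNorm_restrict_le (hN : 0 < N) {s p t q : ℝ} (ht : 1 ≤ t) (htq : t ≤ q)
    {a b : ℝ} (ha : 0 < a) {K : Set (EuclideanSpace ℝ (Fin N))} (hKm : MeasurableSet K)
    (hK : ∀ x ∈ K, a < ‖x‖ ∧ ‖x‖ < b)
    (h : ∃ C : ℝ≥0∞, C ≠ ∞ ∧ ∀ (R : ℝ) (u : EuclideanSpace ℝ (Fin N) → ℝ) (f : ℝ → ℝ),
      MemD0Rad s p R u → IsRadialProfile R u f →
      ∫⁻ r in Ioi a, ‖f r‖ₑ ^ q ≤ C * gagliardo s p univ u ^ q) :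
    ∃ C : ℝ, 0 < C ∧ ∀ R : ℝ, 0 < R → ∀ u : EuclideanSpace ℝ (Fin N) → ℝ,
      MemD0Rad s p R u →
        MemLp u (ENNReal.ofReal t) (volume.restrict K) ∧
        eLpNorm u (ENNReal.ofReal t) (volume.restrict K)
          ≤ ENNReal.ofReal C * gagliardo s p univ u := by
  have ht0 : 0 < t := by linarith
  have hq0 : 0 < q := by linarith
  obtain ⟨C, hC, h⟩ := h
  obtain ⟨C', hC', h'⟩ := exists_lintegral_norm_le (N := N) (b := b) hN ha
  set V := volume K ^ (1 / t - 1 / q) with hV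
  have hKfin : volume K ≠ ∞ := by
    refine ne_top_of_le_ne_top (measure_ball_lt_top (x := 0) (r := b)).ne (measure_mono ?_)
    intro x hx
    simpa using (hK x hx).2
  have hVt : V ≠ ∞ :=
    ENNReal.rpow_ne_top_of_nonneg (sub_nonneg.2 (one_div_le_one_div_of_le ht0 htq)) hKfin
  have hA : (C' * C) ^ (1 / q) * V ≠ ∞ :=
    ENNReal.mul_ne_top (ENNReal.rpow_ne_top_of_nonneg (by positivity)
      (ENNReal.mul_ne_top hC' hC)) hVt
  refine ⟨((C' * C) ^ (1 / q) * V).toReal + 1, by positivity, fun R hR u hu => ?_⟩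
  obtain ⟨f, hf⟩ := hu.exists_isRadialProfile
  have hfm := hf.measurable
  have hae := hu.1.memLp.1.restrict (s := K)
  have hq : eLpNorm u (ENNReal.ofReal q) (volume.restrict K) ≤
      (C' * C) ^ (1 / q) * gagliardo s p univ u := by
    rw [eLpNorm_eq_lintegral_rpow_enorm_toReal (by simpa using hq0) ENNReal.ofReal_ne_top,
      ENNReal.toReal_ofReal hq0.le,
      lintegral_congr_ae (g := fun x => ‖f ‖x‖‖ₑ ^ q) (by
        filter_upwards [ae_restrict_of_ae hf.ae_eq] with x hx
        rw [hx])]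
    calc (∫⁻ x in K, ‖f ‖x‖‖ₑ ^ q) ^ (1 / q)
        ≤ (C' * (C * gagliardo s p univ u ^ q)) ^ (1 / q) := by
          gcongr
          refine (h' K hKm hK (fun r => ‖f r‖ₑ ^ q) (by fun_prop)).trans ?_
          gcongr
          exact h R u f hu hf
      _ = _ := by
          rw [← mul_assoc, ENNReal.mul_rpow_of_nonneg _ _ (by positivity), ← ENNReal.rpow_mul,
            mul_one_div_cancel hq0.ne', ENNReal.rpow_one]
  have hbound : eLpNorm u (ENNReal.ofReal t) (volume.restrict K) ≤
      ENNReal.ofReal (((C' * C) ^ (1 / q) * V).toReal + 1) * gagliardo s p univ u := by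
    refine (eLpNorm_le_eLpNorm_mul_rpow_measure_univ
      (ENNReal.ofReal_le_ofReal htq) hae).trans ?_
    rw [ENNReal.toReal_ofReal ht0.le, ENNReal.toReal_ofReal hq0.le, Measure.restrict_apply_univ,
      ← hV]
    calc _ ≤ (C' * C) ^ (1 / q) * gagliardo s p univ u * V := by gcongr
      _ = ((C' * C) ^ (1 / q) * V) * gagliardo s p univ u := by ring
      _ ≤ _ := by
        gcongr
        rw [ENNReal.ofReal_add ENNReal.toReal_nonneg zero_le_one, ENNReal.ofReal_toReal hA]
        exact le_self_add
  exact ⟨⟨hae, hbound.trans_lt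
    (ENNReal.mul_lt_top ENNReal.ofReal_lt_top hu.1.seminorm_lt_top)⟩, hbound⟩

theorem exists_energy_Ioi_le (hN : 0 < N) {s p : ℝ} (hs : 0 < s) (hp : 0 < p) {a : ℝ}
    (ha : 0 < a) :
    ∃ C : ℝ≥0∞, C ≠ ∞ ∧ ∀ (R : ℝ) (u : EuclideanSpace ℝ (Fin N) → ℝ) (f : ℝ → ℝ),
      IsRadialProfile R u f →
      (∫⁻ ρ in Ioi a, ∫⁻ τ in Ioi a, ‖f ρ - f τ‖ₑ ^ p / ‖ρ - τ‖ₑ ^ (1 + s * p)) ≤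
      C * gagliardo s p univ u ^ p := by
  obtain ⟨C, hC, h⟩ := exists_profile_energy_le hN hs hp
  have h0 : ENNReal.ofReal (a ^ (N - 1)) ≠ 0 := by simpa using pow_pos ha _
  refine ⟨(ENNReal.ofReal (a ^ (N - 1)))⁻¹ * C, ENNReal.mul_ne_top (ENNReal.inv_ne_top.2 h0) hC,
    fun R u f hf => ?_⟩
  have := h R u f hf a ha (Ioi a) measurableSet_Ioi Ioi_subset_Ici_self univ (subset_univ _)
  calc _ = (ENNReal.ofReal (a ^ (N - 1)))⁻¹ * (ENNReal.ofReal (a ^ (N - 1)) *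
        ∫⁻ ρ in Ioi a, ∫⁻ τ in Ioi a, ‖f ρ - f τ‖ₑ ^ p / ‖ρ - τ‖ₑ ^ (1 + s * p)) := by
        rw [← mul_assoc, ENNReal.inv_mul_cancel h0 ENNReal.ofReal_ne_top, one_mul]
    _ ≤ _ := by
        rw [mul_assoc]
        exact mul_le_mul' le_rfl this

theorem exists_lintegral_Ioi_le_of_lt_one (hN : 0 < N) {s p : ℝ} (hs : 0 < s) (hp : 1 ≤ p)
    (hsp : s * p < 1) {a : ℝ} (ha : 0 < a) :
    ∃ C : ℝ≥0∞, C ≠ ∞ ∧ ∀ (R : ℝ) (u : EuclideanSpace ℝ (Fin N) → ℝ) (f : ℝ → ℝ),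
      MemD0Rad s p R u → IsRadialProfile R u f →
      ∫⁻ r in Ioi a, ‖f r‖ₑ ^ (p / (1 - s * p)) ≤
        C * gagliardo s p univ u ^ (p / (1 - s * p)) := by
  have hd : 0 < 1 - s * p := by linarith
  obtain ⟨C, hC, h⟩ := exists_critical_sobolev_Ioi a hs hp hsp
  obtain ⟨C', hC', h'⟩ := exists_energy_Ioi_le (N := N) hN hs (by linarith : 0 < p) ha
  refine ⟨C * C' ^ (1 / (1 - s * p)), ENNReal.mul_ne_top hC
    (ENNReal.rpow_ne_top_of_nonneg (one_div_nonneg.2 hd.le) hC'), fun R u f _ hf => ?_⟩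
  refine (h R f hf.measurable hf.eq_zero).trans ?_
  calc _ ≤ C * (C' * gagliardo s p univ u ^ p) ^ (1 / (1 - s * p)) := by
        gcongr
        exact h' R u f hf
    _ = _ := by
        rw [ENNReal.mul_rpow_of_nonneg _ _ (one_div_nonneg.2 hd.le), ← ENNReal.rpow_mul,
          mul_one_div, mul_assoc]

/-- When sp = 1 the half-line inequality maps t to p(1 + st) = p + t and its last factor has power
1, so each use adds p to the exponent. The start is p*, where the global Sobolev inequality gives a
constant independent of R and the Jacobian is at least a^(N-1) for r > a. -/
theorem exists_lintegral_Ioi_le_of_eq_one (hN : 0 < N) {s p : ℝ} (hs : 0 < s) (hp : 1 ≤ p)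
    (hspN : s * p < N) (hsp : s * p = 1) {a : ℝ} (ha : 0 < a) (k : ℕ) :
    ∃ C : ℝ≥0∞, C ≠ ∞ ∧ ∀ (R : ℝ) (u : EuclideanSpace ℝ (Fin N) → ℝ) (f : ℝ → ℝ),
      MemD0Rad s p R u → IsRadialProfile R u f →
      ∫⁻ r in Ioi a, ‖f r‖ₑ ^ ((N : ℝ) * p / (N - s * p) + k * p) ≤
        C * gagliardo s p univ u ^ ((N : ℝ) * p / (N - s * p) + k * p) := by
  have hp0 : 0 < p := by linarith
  have hN0 : (0 : ℝ) < N := by exact_mod_cast hN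
  have hd : 0 < (N : ℝ) - s * p := by linarith
  set q := (N : ℝ) * p / (N - s * p) with hq
  have hq1 : 1 ≤ q := by
    rw [hq, le_div_iff₀ hd]
    nlinarith [mul_le_mul_of_nonneg_left hp hN0.le]
  have hq0 : 0 < q := by linarith
  induction k with
  | zero =>
    have : Nonempty (Fin N) := ⟨⟨0, hN⟩⟩
    obtain ⟨C, hC, h⟩ := exists_lintegral_rpow_le_gagliardo hN hs hp hspN
    set σ := (volume : Measure (EuclideanSpace ℝ (Fin N))).toSphere univ *
      ENNReal.ofReal (a ^ (N - 1))
    have hσ0 : σ ≠ 0 := mul_ne_zero (Measure.measure_univ_ne_zero.2 (Measure.toSphere_ne_zero _))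
      (by simpa using pow_pos ha _)
    have hσt : σ ≠ ∞ := ENNReal.mul_ne_top (measure_ne_top _ _) ENNReal.ofReal_ne_top
    refine ⟨σ⁻¹ * C, ENNReal.mul_ne_top (ENNReal.inv_ne_top.2 hσ0) hC, fun R u f hu hf => ?_⟩
    have hfm := hf.measurable
    simp only [Nat.cast_zero, zero_mul, add_zero]
    have hcongr : ∫⁻ x, ‖u x‖ₑ ^ q = ∫⁻ x : EuclideanSpace ℝ (Fin N), ‖f ‖x‖‖ₑ ^ q := by
      refine lintegral_congr_ae ?_
      filter_upwards [hf.ae_eq] with x hx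
      rw [hx]
    have hfin : ∫⁻ x : EuclideanSpace ℝ (Fin N), ‖f ‖x‖‖ₑ ^ q ≠ ∞ := by
      rw [← hcongr]
      have := lintegral_rpow_enorm_lt_top_of_eLpNorm_lt_top (by simpa using hq0)
        ENNReal.ofReal_ne_top hu.1.memLp.2
      rw [ENNReal.toReal_ofReal hq0.le] at this
      exact this.ne
    have h1 := h (fun x => f ‖x‖) (by fun_prop) hfin
    rw [← gagliardo_congr_ae hf.ae_eq,
      lintegral_fun_norm _ (F := fun r => ‖f r‖ₑ ^ q) (by fun_prop),
      finrank_euclideanSpace_fin] at h1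
    have h2 : σ * ∫⁻ r in Ioi a, ‖f r‖ₑ ^ q ≤ C * gagliardo s p univ u ^ q := by
      refine le_trans ?_ h1
      rw [mul_assoc, ← lintegral_const_mul _ (by fun_prop)]
      refine mul_le_mul' le_rfl ?_
      refine (setLIntegral_mono' measurableSet_Ioi fun r hr => ?_).trans
        (lintegral_mono_set (Ioi_subset_Ioi ha.le))
      gcongr
      exact le_of_lt hr
    calc _ = σ⁻¹ * (σ * ∫⁻ r in Ioi a, ‖f r‖ₑ ^ q) := by
          rw [← mul_assoc, ENNReal.inv_mul_cancel hσ0 hσt, one_mul]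
      _ ≤ σ⁻¹ * (C * gagliardo s p univ u ^ q) := by gcongr
      _ = _ := by rw [mul_assoc]
  | succ k ih =>
    obtain ⟨C, hC, ih⟩ := ih
    have hk0 : 0 ≤ (k : ℝ) * p := by positivity
    set t := q + k * p with ht
    obtain ⟨C₁, hC₁, h₁⟩ := exists_sobolev_gagliardo_Ioi a hs hp (by linarith : 1 ≤ t)
    obtain ⟨C₂, hC₂, h₂⟩ := exists_energy_Ioi_le (N := N) hN hs hp0 ha
    have e : q + (k + 1 : ℕ) * p = p + t := by rw [ht]; push_cast; ring
    refine ⟨C₁ * (C₂ * C), ENNReal.mul_ne_top hC₁ (ENNReal.mul_ne_top hC₂ hC),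
      fun R u f hu hf => ?_⟩
    have hfin : ∫⁻ r in Ioi a, ‖f r‖ₑ ^ t ≠ ∞ :=
      ne_top_of_le_ne_top (ENNReal.mul_ne_top hC (ENNReal.rpow_ne_top_of_nonneg (by linarith)
        hu.1.seminorm_lt_top.ne)) (ih R u f hu hf)
    have := h₁ f hf.measurable hfin
    rw [show p * (1 + s * t) = p + t by linear_combination t * hsp] at this
    nth_rewrite 2 [hsp] at this
    rw [ENNReal.rpow_one] at this
    rw [e, ENNReal.rpow_add_of_nonneg p t hp0.le (by linarith)]
    calc _ ≤ _ := this
      _ ≤ C₁ * ((C₂ * gagliardo s p univ u ^ p) * (C * gagliardo s p univ u ^ t)) := by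
          gcongr
          · exact h₂ R u f hf
          · exact ih R u f hu hf
      _ = _ := by ring

end Embedding

/-! ### Pointwise decay for sp > 1. -/

section Pointwise

open Metric Set Filter Topology

variable {N : ℕ}

/-- Finite energy on (1/(n+1), ∞) makes the density finite almost everywhere there. Countably many n
yield one null set that serves all a > 0. -/
theorem ae_gagliardo_density_ne_top (hN : 0 < N) {s p R : ℝ} (hs : 0 < s) (hp : 0 < p)
    {u : EuclideanSpace ℝ (Fin N) → ℝ} {f : ℝ → ℝ} (hu : MemD0Rad s p R u)
    (hf : IsRadialProfile R u f) :
    ∀ᵐ ρ : ℝ, ∀ a, 0 < a → a < ρ →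
      ∫⁻ τ in Ioi a, ‖f ρ - f τ‖ₑ ^ p / ‖ρ - τ‖ₑ ^ (1 + s * p) ≠ ∞ := by
  have hfm := hf.measurable
  have h : ∀ n : ℕ, ∀ᵐ ρ : ℝ, 1 / ((n : ℝ) + 1) < ρ →
      ∫⁻ τ in Ioi (1 / ((n : ℝ) + 1)), ‖f ρ - f τ‖ₑ ^ p / ‖ρ - τ‖ₑ ^ (1 + s * p) ≠ ∞ := by
    intro n
    have hn : 0 < 1 / ((n : ℝ) + 1) := by positivity
    obtain ⟨C, hC, h⟩ := exists_energy_Ioi_le (N := N) hN hs hp hn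
    have hfin := ne_top_of_le_ne_top (ENNReal.mul_ne_top hC
      (ENNReal.rpow_ne_top_of_nonneg hp.le hu.1.seminorm_lt_top.ne)) (h R u f hf)
    have hm : Measurable fun ρ => ∫⁻ τ in Ioi (1 / ((n : ℝ) + 1)),
        ‖f ρ - f τ‖ₑ ^ p / ‖ρ - τ‖ₑ ^ (1 + s * p) := by
      refine Measurable.lintegral_prod_right'
        (f := fun q : ℝ × ℝ => ‖f q.1 - f q.2‖ₑ ^ p / ‖q.1 - q.2‖ₑ ^ (1 + s * p)) ?_
      fun_prop
    have := ae_lt_top hm hfin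
    rw [ae_restrict_iff' measurableSet_Ioi] at this
    filter_upwards [this] with ρ h hρ
    exact (h hρ).ne
  filter_upwards [ae_all_iff.2 h] with ρ h a ha haρ
  obtain ⟨n, hn⟩ := exists_nat_one_div_lt ha
  exact ne_top_of_le_ne_top (h n (hn.trans haρ)) (lintegral_mono_set (Ioi_subset_Ioi hn.le))

/-- The pointwise bound for the profile of a radial function in the case `1 < s * p`. -/
theorem exists_profile_pointwise_le (hN : 0 < N) {s p : ℝ} (hs : 0 < s) (hp : 1 ≤ p)
    (hsp : 1 < s * p) :
    ∃ C : ℝ≥0∞, C ≠ ∞ ∧ ∀ (R : ℝ) (u : EuclideanSpace ℝ (Fin N) → ℝ) (f : ℝ → ℝ),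
      MemD0Rad s p R u → IsRadialProfile R u f → ∀ᵐ ρ ∂volume.restrict (Ioi (0 : ℝ)),
        ENNReal.ofReal (ρ ^ (N - 1)) ^ (1 / p) * ‖f ρ‖ₑ ≤
          C * (ENNReal.ofReal R ^ ((s * p - 1) / p) * gagliardo s p (ball 0 R) u) := by
  have hp0 : 0 < p := by linarith
  set α := (s * p - 1) / p with hα
  have hα0 : 0 < α := div_pos (by linarith) hp0
  set C₁ : ℝ≥0∞ := 2 * (2 ^ (1 / p) * (1 - 2⁻¹ ^ α)⁻¹) with hC₁
  have hC₁t : C₁ ≠ ∞ := by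
    refine ENNReal.mul_ne_top (by simp) (ENNReal.mul_ne_top
      (ENNReal.rpow_ne_top_of_nonneg (by positivity) (by simp)) (ENNReal.inv_ne_top.2 ?_))
    exact (tsub_pos_of_lt (ENNReal.rpow_lt_one (by simp) hα0)).ne'
  obtain ⟨C₂, hC₂, henergy⟩ := exists_profile_energy_le hN hs hp0
  have hCt : C₁ * C₂ ^ (1 / p) ≠ ∞ :=
    ENNReal.mul_ne_top hC₁t (ENNReal.rpow_ne_top_of_nonneg (by positivity) hC₂)
  refine ⟨C₁ * C₂ ^ (1 / p), hCt, fun R u f hu hf => ?_⟩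
  set C := C₁ * C₂ ^ (1 / p)
  have hfm := hf.measurable
  have hgood := ae_gagliardo_density_ne_top hN hs hp0 hu hf
  set good := {ρ : ℝ | ∀ a, 0 < a → a < ρ →
      ∫⁻ τ in Ioi a, ‖f ρ - f τ‖ₑ ^ p / ‖ρ - τ‖ₑ ^ (1 + s * p) ≠ ∞} with hgd
  have hdense : Dense good := Measure.dense_of_ae hgood
  have morrey : ∀ ρ c d : ℝ, 0 < ρ → ρ ≤ c → c < d → c ∈ good → d ∈ good →
      ∀ Ω : Set (EuclideanSpace ℝ (Fin N)), norm ⁻¹' (Ioo c d) ⊆ Ω →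
      ENNReal.ofReal (ρ ^ (N - 1)) ^ (1 / p) * ‖f c - f d‖ₑ ≤
        C * (ENNReal.ofReal (d - c) ^ α * gagliardo s p Ω u) := by
    intro ρ c d hρ hρc hcd hc hd Ω hΩ
    have hsub : Ioo c d ⊆ Ioi (ρ / 2) := fun y hy => by
      have := hy.1
      simp only [mem_Ioi]
      linarith
    have hden : ∀ x ∈ good, ρ ≤ x →
        ∫⁻ y in Ioo c d, ‖f x - f y‖ₑ ^ p / ‖x - y‖ₑ ^ (1 + s * p) ≠ ∞ := fun x hx hρx =>
      ne_top_of_le_ne_top (hx (ρ / 2) (by positivity) (by linarith)) (lintegral_mono_set hsub)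
    have h1 := enorm_sub_le_gagliardo_Ioo hfm hp hsp hcd (hden c hc hρc)
      (hden d hd (hρc.trans hcd.le))
    have h2 := henergy R u f hf ρ hρ (Ioo c d) measurableSet_Ioo
      (fun y hy => hρc.trans hy.1.le) Ω hΩ
    set D := ∫⁻ y in Ioo c d, ∫⁻ z in Ioo c d, ‖f y - f z‖ₑ ^ p / ‖y - z‖ₑ ^ (1 + s * p)
    calc ENNReal.ofReal (ρ ^ (N - 1)) ^ (1 / p) * ‖f c - f d‖ₑ
        ≤ ENNReal.ofReal (ρ ^ (N - 1)) ^ (1 / p) *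
            (C₁ * (ENNReal.ofReal (d - c) ^ α * D ^ (1 / p))) := by gcongr
      _ = C₁ * (ENNReal.ofReal (d - c) ^ α * (ENNReal.ofReal (ρ ^ (N - 1)) * D) ^ (1 / p)) := by
          rw [ENNReal.mul_rpow_of_nonneg _ _ (by positivity : 0 ≤ 1 / p)]
          ring
      _ ≤ C₁ * (ENNReal.ofReal (d - c) ^ α * (C₂ * gagliardo s p Ω u ^ p) ^ (1 / p)) := by
          gcongr
      _ = _ := by
          rw [ENNReal.mul_rpow_of_nonneg _ _ (by positivity : 0 ≤ 1 / p), ← ENNReal.rpow_mul,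
            mul_one_div_cancel hp0.ne', ENNReal.rpow_one]
          ring
  filter_upwards [ae_restrict_of_ae hgood, ae_restrict_mem measurableSet_Ioi] with ρ hρg hρ0
  have hρ0 : 0 < ρ := hρ0
  by_cases hρR : R ≤ ρ
  · simp [hf.eq_zero ρ hρR]
  push Not at hρR
  -- To keep only the seminorm over B_R, the path from ρ stops at a good τ just inside R. A second
  -- jump, shorter than ε, reaches a good τ' beyond R, where f = 0. It is paid for with the finite
  -- full-space seminorm times ε^α, which vanishes as ε → 0.
  have hlim : Tendsto (fun ε : ℝ => C * (ENNReal.ofReal R ^ α * gagliardo s p (ball 0 R) u) +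
      C * (ENNReal.ofReal ε ^ α * gagliardo s p univ u)) (𝓝[>] 0)
      (𝓝 (C * (ENNReal.ofReal R ^ α * gagliardo s p (ball 0 R) u) +
        C * (0 * gagliardo s p univ u))) := by
    refine tendsto_const_nhds.add (ENNReal.Tendsto.const_mul (ENNReal.Tendsto.mul_const ?_
      (Or.inr hu.1.seminorm_lt_top.ne)) (Or.inr hCt))
    have : Continuous fun ε : ℝ => ENNReal.ofReal ε ^ α :=
      ENNReal.continuous_rpow_const.comp ENNReal.continuous_ofReal
    have h0 := (this.tendsto 0).mono_left (nhdsWithin_le_nhds (s := Ioi 0))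
    rwa [ENNReal.ofReal_zero, ENNReal.zero_rpow_of_pos hα0] at h0
  rw [zero_mul, mul_zero, add_zero] at hlim
  refine ge_of_tendsto hlim ?_
  filter_upwards [self_mem_nhdsWithin] with ε hε
  have hε : 0 < ε := hε
  obtain ⟨τ, hτg, hτ⟩ := hdense.exists_between (max_lt hρR (by linarith : R - ε / 2 < R))
  obtain ⟨τ', hτg', hτ'⟩ := hdense.exists_between (by linarith : R < R + ε / 2)
  have hρτ : ρ < τ := (le_max_left _ _).trans_lt hτ.1
  have hRτ : R - ε / 2 < τ := (le_max_right _ _).trans_lt hτ.1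
  have m1 := morrey ρ ρ τ hρ0 le_rfl hρτ hρg hτg (ball 0 R) (fun x hx => by
    rw [mem_ball_zero_iff]
    exact hx.2.trans hτ.2)
  have m2 := morrey ρ τ τ' hρ0 hρτ.le (hτ.2.trans hτ'.1) hτg hτg' univ (subset_univ _)
  calc ENNReal.ofReal (ρ ^ (N - 1)) ^ (1 / p) * ‖f ρ‖ₑ
      ≤ ENNReal.ofReal (ρ ^ (N - 1)) ^ (1 / p) * (‖f ρ - f τ‖ₑ + ‖f τ - f τ'‖ₑ) := by
        gcongr
        rw [hf.eq_zero τ' hτ'.1.le, sub_zero]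
        simpa using enorm_add_le (f ρ - f τ) (f τ)
    _ ≤ _ := by
        rw [mul_add]
        refine add_le_add (m1.trans ?_) (m2.trans ?_)
        · gcongr
          linarith [hτ.2]
        · gcongr
          linarith [hτ'.2]

/-- The powers of r on the right collect to r^(-1/p), so after cancelling R^s the claim is R^(-1/p)
≤ r^(-1/p). -/
theorem radial_lemma_exponent_le {s p r R : ℝ} (hp : 0 < p) (hN : 0 < N)
    (hr : 0 < r) (hrR : r ≤ R) :
    R ^ ((s * p - 1) / p) ≤
      (r ^ (N - 1)) ^ (1 / p) * (r ^ (-(((N : ℝ) - s * p) / p)) * (R / r) ^ s) := by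
  have hR : 0 < R := hr.trans_le hrR
  have h1 : (r ^ (N - 1)) ^ (1 / p) = r ^ (((N : ℝ) - 1) / p) := by
    rw [← Real.rpow_natCast, ← Real.rpow_mul hr.le, Nat.cast_sub hN, mul_one_div, Nat.cast_one]
  rw [h1, Real.div_rpow hR.le hr.le, div_eq_mul_inv (R ^ s), ← Real.rpow_neg hr.le,
    mul_left_comm (r ^ _) (R ^ s), mul_left_comm, ← Real.rpow_add hr, ← Real.rpow_add hr,
    show ((N : ℝ) - 1) / p + (-(((N : ℝ) - s * p) / p) + -s) = -(1 / p) by field_simp; ring,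
    show (s * p - 1) / p = s + -(1 / p) by field_simp; ring, Real.rpow_add hR]
  refine mul_le_mul_of_nonneg_left ?_ (by positivity)
  exact Real.rpow_le_rpow_of_nonpos hr hrR (by simpa using hp.le)

/-- The radial lemma: pointwise decay in the case `1 < s * p`. -/
theorem exists_radial_pointwise_le (hN : 0 < N) {s p : ℝ} (hs : 0 < s) (hp : 1 ≤ p)
    (hsp : 1 < s * p) :
    ∃ C : ℝ, 0 < C ∧ ∀ R : ℝ, 0 < R → ∀ u : EuclideanSpace ℝ (Fin N) → ℝ,
      MemD0Rad s p R u → ∀ᵐ x ∂(volume : Measure (EuclideanSpace ℝ (Fin N))),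
        ‖u x‖ₑ ≤ ENNReal.ofReal (C * ‖x‖ ^ (-(((N : ℝ) - s * p) / p)) * (R / ‖x‖) ^ s)
          * gagliardo s p (ball 0 R) u := by
  have hp0 : 0 < p := by linarith
  have : Nonempty (Fin N) := ⟨⟨0, hN⟩⟩
  obtain ⟨C, hC, h⟩ := exists_profile_pointwise_le hN hs hp hsp
  refine ⟨C.toReal + 1, by positivity, fun R hR u hu => ?_⟩
  obtain ⟨f, hf⟩ := hu.exists_isRadialProfile
  filter_upwards [ae_norm_of_ae_Ioi hN (h R u f hu hf), hf.ae_eq, Measure.ae_ne volume 0]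
    with x hx hux hx0
  have hr : 0 < ‖x‖ := norm_pos_iff.2 hx0
  rw [hux]
  by_cases hxR : R ≤ ‖x‖
  · simp [hf.eq_zero _ hxR]
  push Not at hxR
  set r := ‖x‖
  set W := (r ^ (N - 1)) ^ (1 / p) with hW
  have hW0 : 0 < W := by positivity
  have hWof : ENNReal.ofReal (r ^ (N - 1)) ^ (1 / p) = ENNReal.ofReal W :=
    ENNReal.ofReal_rpow_of_pos (by positivity)
  have hRof : ENNReal.ofReal R ^ ((s * p - 1) / p) = ENNReal.ofReal (R ^ ((s * p - 1) / p)) :=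
    ENNReal.ofReal_rpow_of_pos hR
  rw [hWof, hRof] at hx
  have hWne : ENNReal.ofReal W ≠ 0 := by simpa using hW0
  rw [← ENNReal.mul_le_mul_iff_right hWne ENNReal.ofReal_ne_top]
  refine hx.trans ?_
  rw [← mul_assoc, ← mul_assoc, ← ENNReal.ofReal_mul hW0.le, ← ENNReal.ofReal_toReal hC,
    ← ENNReal.ofReal_mul ENNReal.toReal_nonneg, ENNReal.toReal_ofReal ENNReal.toReal_nonneg]
  refine mul_le_mul' (ENNReal.ofReal_le_ofReal ?_) le_rfl
  calc C.toReal * R ^ ((s * p - 1) / p)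
      ≤ (C.toReal + 1) * (W * (r ^ (-(((N : ℝ) - s * p) / p)) * (R / r) ^ s)) := by
        gcongr
        · linarith
        · exact radial_lemma_exponent_le hp0 hN hr hxR.le
    _ = _ := by ring

theorem MemD0Rad.memLp_top_restrict {s p : ℝ} (hs : 0 < s) (hp : 0 < p) {R : ℝ} (hR : 0 < R)
    {C : ℝ} (hC : 0 < C) {a b : ℝ} (ha : 0 < a) {K : Set (EuclideanSpace ℝ (Fin N))}
    (hKm : MeasurableSet K) (hK : ∀ x ∈ K, a < ‖x‖ ∧ ‖x‖ < b)
    {u : EuclideanSpace ℝ (Fin N) → ℝ} (hu : MemD0Rad s p R u)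
    (h : ∀ᵐ x ∂(volume : Measure (EuclideanSpace ℝ (Fin N))),
        ‖u x‖ₑ ≤ ENNReal.ofReal (C * ‖x‖ ^ (-(((N : ℝ) - s * p) / p)) * (R / ‖x‖) ^ s)
          * gagliardo s p (ball 0 R) u) :
    MemLp (fun x => ‖x‖ ^ (((N : ℝ) - s * p) / p) * u x) ∞ (volume.restrict K) ∧
      eLpNorm (fun x => ‖x‖ ^ (((N : ℝ) - s * p) / p) * u x) ∞ (volume.restrict K)
        ≤ ENNReal.ofReal (C * (R / a) ^ s) * gagliardo s p univ u := by
  have hbound : eLpNorm (fun x => ‖x‖ ^ (((N : ℝ) - s * p) / p) * u x) ∞ (volume.restrict K)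
        ≤ ENNReal.ofReal (C * (R / a) ^ s) * gagliardo s p univ u := by
    rw [eLpNorm_exponent_top]
    refine essSup_le_of_ae_le _ ?_
    filter_upwards [ae_restrict_of_ae h, ae_restrict_mem hKm] with x hx hxK
    have hax := (hK x hxK).1
    have hr : 0 < ‖x‖ := ha.trans hax
    rw [enorm_mul, ← ofReal_norm (‖x‖ ^ _), Real.norm_of_nonneg (by positivity)]
    refine (mul_le_mul' le_rfl hx).trans ?_
    rw [← mul_assoc, ← ENNReal.ofReal_mul (by positivity)]
    refine mul_le_mul' (ENNReal.ofReal_le_ofReal ?_) ?_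
    · calc ‖x‖ ^ (((N : ℝ) - s * p) / p) *
            (C * ‖x‖ ^ (-(((N : ℝ) - s * p) / p)) * (R / ‖x‖) ^ s)
          = (‖x‖ ^ (((N : ℝ) - s * p) / p) * ‖x‖ ^ (-(((N : ℝ) - s * p) / p))) *
            (C * (R / ‖x‖) ^ s) := by ring
        _ = C * (R / ‖x‖) ^ s := by
            rw [← Real.rpow_add hr, add_neg_cancel, Real.rpow_zero, one_mul]
        _ ≤ _ := by gcongr
    · exact gagliardo_mono hp (subset_univ _) u
  refine ⟨⟨?_, hbound.trans_lt
    (ENNReal.mul_lt_top ENNReal.ofReal_lt_top hu.1.seminorm_lt_top)⟩, hbound⟩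
  have hm : Measurable fun x : EuclideanSpace ℝ (Fin N) => ‖x‖ ^ (((N : ℝ) - s * p) / p) := by
    fun_prop
  exact hm.aestronglyMeasurable.mul hu.1.memLp.1.restrict

end Pointwise

theorem lemma4p3 (N : ℕ) (s p : ℝ) (hs0 : 0 < s) (hs1 : s < 1) (hp : 1 < p)
    (hspN : s * p < (N : ℝ)) :
    -- case `s p > 1`: the pointwise bound, and the embedding into weighted `L^∞_loc`
    (1 < s * p →
      (∃ C : ℝ, 0 < C ∧ ∀ R : ℝ, 0 < R → ∀ u : EuclideanSpace ℝ (Fin N) → ℝ,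
        MemD0Rad s p R u →
          ∀ᵐ x ∂(volume : Measure (EuclideanSpace ℝ (Fin N))),
            ‖u x‖ₑ ≤ ENNReal.ofReal
                (C * ‖x‖ ^ (-(((N : ℝ) - s * p) / p)) * (R / ‖x‖) ^ s)
              * gagliardo s p (Metric.ball 0 R) u) ∧
      (∀ R : ℝ, 0 < R → ∀ K : Set (EuclideanSpace ℝ (Fin N)), CompactlyContained K {0}ᶜ →
        ∃ C : ℝ, 0 < C ∧ ∀ u : EuclideanSpace ℝ (Fin N) → ℝ, MemD0Rad s p R u →
          MemLp (fun x => ‖x‖ ^ (((N : ℝ) - s * p) / p) * u x) ∞ (volume.restrict K) ∧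
          eLpNorm (fun x => ‖x‖ ^ (((N : ℝ) - s * p) / p) * u x) ∞ (volume.restrict K)
            ≤ ENNReal.ofReal C * gagliardo s p Set.univ u)) ∧
    -- case `s p < 1`: the embedding into `L^{p/(1-sp)}_loc`
    (s * p < 1 →
      ∀ K : Set (EuclideanSpace ℝ (Fin N)), CompactlyContained K {0}ᶜ →
        ∃ C : ℝ, 0 < C ∧ ∀ R : ℝ, 0 < R → ∀ u : EuclideanSpace ℝ (Fin N) → ℝ,
          MemD0Rad s p R u →
            MemLp u (ENNReal.ofReal (p / (1 - s * p))) (volume.restrict K) ∧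
            eLpNorm u (ENNReal.ofReal (p / (1 - s * p))) (volume.restrict K)
              ≤ ENNReal.ofReal C * gagliardo s p Set.univ u) ∧
    -- case `s p = 1`: the embedding into `L^t_loc` for every finite `t`
    (s * p = 1 →
      ∀ t : ℝ, 1 ≤ t →
      ∀ K : Set (EuclideanSpace ℝ (Fin N)), CompactlyContained K {0}ᶜ →
        ∃ C : ℝ, 0 < C ∧ ∀ R : ℝ, 0 < R → ∀ u : EuclideanSpace ℝ (Fin N) → ℝ,
          MemD0Rad s p R u →
            MemLp u (ENNReal.ofReal t) (volume.restrict K) ∧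
            eLpNorm u (ENNReal.ofReal t) (volume.restrict K)
              ≤ ENNReal.ofReal C * gagliardo s p Set.univ u) := by
  have hN0 : (0 : ℝ) < N := (mul_pos hs0 (by linarith)).trans hspN
  have hN : 0 < N := by exact_mod_cast hN0
  have hp0 : 0 < p := by linarith
  refine ⟨fun hsp => ?_, fun hsp K hK => ?_, fun hsp t ht K hK => ?_⟩
  · have h := exists_radial_pointwise_le hN hs0 hp.le hsp
    refine ⟨h, fun R hR K hK => ?_⟩
    obtain ⟨C, hC, h⟩ := h
    obtain ⟨a, b, ha, -, hab⟩ := hK.exists_annulus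
    exact ⟨C * (R / a) ^ s, by positivity, fun u hu =>
      hu.memLp_top_restrict hs0 hp0 hR hC ha hK.1.measurableSet hab (h R hR u hu)⟩
  · obtain ⟨a, b, ha, -, hab⟩ := hK.exists_annulus
    have hd : 0 < 1 - s * p := by linarith
    have hq : 1 ≤ p / (1 - s * p) := by
      rw [le_div_iff₀ hd]
      linarith [mul_pos hs0 hp0]
    exact exists_eLpNorm_restrict_le hN hq le_rfl ha hK.1.measurableSet hab
      (exists_lintegral_Ioi_le_of_lt_one hN hs0 hp.le hsp ha)
  · obtain ⟨a, b, ha, -, hab⟩ := hK.exists_annulus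
    -- As p > 1, k ≥ t iterations already bring the exponent p* + kp above t.
    obtain ⟨k, hk⟩ := exists_nat_ge t
    have hq : 0 ≤ (N : ℝ) * p / (N - s * p) := div_nonneg (by positivity) (by linarith)
    have htk : t ≤ (N : ℝ) * p / (N - s * p) + k * p := by
      nlinarith [mul_le_mul_of_nonneg_left hp.le (k.cast_nonneg (α := ℝ))]
    exact exists_eLpNorm_restrict_le hN ht htk ha hK.1.measurableSet hab
      (exists_lintegral_Ioi_le_of_eq_one hN hs0 hp.le hspN hsp ha k)
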